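/- Let $N,d\ge 2$ and let $X=(X_1,\dots,X_d)$ be locally Lipschitz vector fields on $\mathbb R^N$, regarded as first order operators; for $u\in C^1$ put $Xu=(X_1u,\dots,X_du)$. An absolutely continuous path $\gamma:[0,T]\to\mathbb R^N$ is called $X$-subunit if for a.e. $t$ one has $\dot\gamma(t)=\sum_j\theta_j(t)X_j(\gamma(t))$ with $\sum_j\theta_j(t)^2\le 1$. Assume that any two points of $\mathbb R^N$ are joined by an $X$-subunit path, let $\delta(x,y)$ be the infimum of the $T>0$ for which there is an $X$-subunit path $\gamma:[0,T]\to\mathbb R^N$ from $x$ to $y$, and let $B_r=B_r(x)$ denote the $\delta$-balls and $|\cdot|$ Lebesgue measure. Assume: 1. $|y-x|\to0$ if and only if $\delta(x,y)\to0$; 2. $0<|B_{2r}|\le 2^Q|B_r|$ for all $\delta$-balls, where $Q>1$ is a constant; 3. there are constants $C_P,\nu>0$ such that for every $\delta$-ball $B_r$ and every $u\in C^1(\overline{B_{\nu r}})$ integrable on $B_r$, with $u_r$ the mean of $u$ on $B_r$, $$\frac1{|B_r|}\int_{B_r}|u-u_r|\,dx\le C_P\,r\,\frac1{|B_{\nu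 r}|}\int_{B_{\nu r}}|Xu|\,dx .$$ Let $\Omega\subset\mathbb R^N$ be bounded and open, and let $W^{1,Q}_0(\Omega,X)$ be the closure of $C_c^\infty(\Omega)$ under the norm $\|Xu\|_{L^Q(\Omega)}$; its elements $u$ are identified with the functions that are the $L^1(\Omega)$-limits of sequences $\varphi_n\in C_c^\infty(\Omega)$ for which $X\varphi_n$ converges in $L^Q(\Omega)$, and $Xu$ is the limit of $X\varphi_n$. Let $Q'=Q/(Q-1)$ and let $a:\Omega\times\mathbb R\times\mathbb R^d\to\mathbb R^d$ be a Carathéodory function for which there are constants $\alpha,\beta>0$ and $h\in L^{Q'}(\Omega)$ such that, for a.e. $x\in\Omega$, all $s\in\mathbb R$ and all $\xi\neq\eta$ in $\mathbb R^d$, $$a(x,s,\xi)\cdot\xi\ge\alpha|\xi|^Q,\qquad |a(x,s,\xi)|\le\beta\big(h(x)+|s|^{Q-1}+|\xi|^{Q-1}\big),\qquad [a(x,s,\xi)-a(x,s,\eta)]\cdot(\xi-\eta)>0 .$$ Let $F\in (L^m(\Omega))^d$ for some $m>Q'$, and let $u$ be a weak solution of $X^*a(x,u,Xu)=X^*F$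 in $\Omega$, $u=0$ on $\partial\Omega$, that is, $u\in W^{1,Q}_0(\Omega,X)$ and $$\int_\Omega a(x,u,Xu)\cdot Xv\,dx=\int_\Omega F\cdot Xv\,dx\qquad\text{for all } v\in W^{1,Q}_0(\Omega,X).$$ Then $u\in L^\infty(\Omega)$. -/

import Mathlib

open MeasureTheory Set Filter Topology
open scoped ENNReal ContDiff

noncomputable section

namespace XElliptic

/-- `ℝⁿ` with its Euclidean norm. -/
abbrev E (n : ℕ) : Type := EuclideanSpace ℝ (Fin n)

variable {N d : ℕ}

/-- The `X`-gradient `(X₁u, …, X_d u)` of a `C¹` function `u`, where the vector field `X j` acts as the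
first order operator `∑ₖ c_{jk} ∂ₖ`, i.e. as the derivative of `u` in the direction `X j x`. -/
def xgrad (X : Fin d → E N → E N) (u : E N → ℝ) (x : E N) : E d :=
  WithLp.toLp 2 (fun j => fderiv ℝ u x (X j x))

/-- `γ : [0, T] → ℝᴺ` is an `X`-subunit path: it is absolutely continuous and, for almost every `t`,
`γ'(t) = ∑ⱼ θⱼ(t) Xⱼ(γ(t))` with `∑ⱼ θⱼ(t)² ≤ 1`. -/
def IsSubunit (X : Fin d → E N → E N) (T : ℝ) (γ : ℝ → E N) : Prop :=
  AbsolutelyContinuousOnInterval γ 0 T ∧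
    ∃ θ : ℝ → Fin d → ℝ, ∀ᵐ t ∂(volume.restrict (Icc 0 T)),
      HasDerivAt γ (∑ j, θ t j • X j (γ t)) t ∧ ∑ j, θ t j ^ 2 ≤ 1

/-- The times `T > 0` in which `y` can be reached from `x` along an `X`-subunit path. -/
def travelTimes (X : Fin d → E N → E N) (x y : E N) : Set ℝ :=
  {T | 0 < T ∧ ∃ γ : ℝ → E N, IsSubunit X T γ ∧ γ 0 = x ∧ γ T = y}

/-- Any two points are joined by an `X`-subunit path. -/
def IsXConnected (X : Fin d → E N → E N) : Prop :=
  ∀ x y : E N, (travelTimes X x y).Nonempty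

/-- The Carnot–Carathéodory (control) distance. It is used only for families `X` for which
`IsXConnected X` holds, so that the infimum is over a nonempty set. -/
def ccDist (X : Fin d → E N → E N) (x y : E N) : ℝ :=
  sInf (travelTimes X x y)

/-- The ball of the control distance. -/
def ccBall (X : Fin d → E N → E N) (x : E N) (r : ℝ) : Set (E N) :=
  {y | ccDist X x y < r}

/-- The geometric assumptions on the family of vector fields, with doubling exponent `Q`. -/
structure IsAdmissible (X : Fin d → E N → E N) (Q : ℝ) : Prop where
  /-- The vector fields are locally Lipschitz. -/
  locallyLipschitz : ∀ j, LocallyLipschitz (X j)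
  /-- The control distance is finite. -/
  connected : IsXConnected X
  /-- The control distance induces the Euclidean convergence: `|yₙ - x| → 0 ↔ δ(x, yₙ) → 0`. -/
  tendsto_iff : ∀ (x : E N) (y : ℕ → E N),
    Tendsto y atTop (𝓝 x) ↔ Tendsto (fun n => ccDist X x (y n)) atTop (𝓝 0)
  /-- The doubling property of Lebesgue measure on the balls of the control distance. -/
  doubling : ∀ (x : E N) (r : ℝ), 0 < r →
    0 < volume (ccBall X x (2 * r)) ∧
      volume (ccBall X x (2 * r)) ≤ ENNReal.ofReal ((2 : ℝ) ^ Q) * volume (ccBall X x r)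
  /-- The `(1,1)`-Poincaré inequality. A function that is `C¹` near the closed set `closure B_{νr}`
  agrees there with a function that is `C¹` on `ℝᴺ`, so the latter suffice. The two averages
  are `[0, ∞]`-valued; integrability on `B_r` gives a meaning to the mean value `u_r`. -/
  poincare : ∃ C ν : ℝ, 0 < C ∧ 0 < ν ∧
    ∀ (x : E N) (r : ℝ), 0 < r → ∀ u : E N → ℝ, ContDiff ℝ 1 u →
      IntegrableOn u (ccBall X x r) →
      (⨍⁻ y in ccBall X x r, ‖u y - (⨍ z in ccBall X x r, u z ∂volume)‖ₑ ∂volume) ≤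
        ENNReal.ofReal (C * r) *
          (⨍⁻ y in ccBall X x (ν * r), ‖xgrad X u y‖ₑ ∂volume)

/-- `φ ∈ C_c^∞(Ω)`, extended by zero to `ℝᴺ`. -/
def IsTestFunction (Ω : Set (E N)) (φ : E N → ℝ) : Prop :=
  ContDiff ℝ ∞ φ ∧ HasCompactSupport φ ∧ tsupport φ ⊆ Ω

/-- `u` belongs to `W₀^{1,p}(Ω, X)`, the closure of `C_c^∞(Ω)` for the norm `‖Xu‖_{Lᵖ(Ω)}`, and `U` is
its `X`-gradient: there are `φₙ ∈ C_c^∞(Ω)` with `Xφₙ → U` in `Lᵖ(Ω)`, and `u` is the function which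
the `φₙ` approximate (in `L¹(Ω)`). -/
def IsSobolevZero (X : Fin d → E N → E N) (Ω : Set (E N)) (p : ℝ)
    (u : E N → ℝ) (U : E N → E d) : Prop :=
  MemLp u 1 (volume.restrict Ω) ∧ MemLp U (ENNReal.ofReal p) (volume.restrict Ω) ∧
    ∃ φ : ℕ → E N → ℝ, (∀ n, IsTestFunction Ω (φ n)) ∧
      Tendsto (fun n => eLpNorm (φ n - u) 1 (volume.restrict Ω)) atTop (𝓝 0) ∧
      Tendsto (fun n => eLpNorm (xgrad X (φ n) - U) (ENNReal.ofReal p) (volume.restrict Ω))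
        atTop (𝓝 0)

/-- `a : Ω × ℝ × ℝᵈ → ℝᵈ` is a Carathéodory function. -/
def IsCaratheodory (Ω : Set (E N)) (a : E N → ℝ → E d → E d) : Prop :=
  (∀ (s : ℝ) (ξ : E d), AEStronglyMeasurable (fun x => a x s ξ) (volume.restrict Ω)) ∧
    ∀ᵐ x ∂(volume.restrict Ω), Continuous (fun z : ℝ × E d => a x z.1 z.2)

/-- The structure conditions on `a`: coercivity, growth of order `p - 1`, strict monotonicity. -/
structure IsLerayLions (Ω : Set (E N)) (p : ℝ) (a : E N → ℝ → E d → E d) : Prop where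
  caratheodory : IsCaratheodory Ω a
  coercive : ∃ α : ℝ, 0 < α ∧ ∀ᵐ x ∂(volume.restrict Ω), ∀ (s : ℝ) (ξ : E d),
    α * ‖ξ‖ ^ p ≤ inner ℝ (a x s ξ) ξ
  growth : ∃ (β : ℝ) (h : E N → ℝ), 0 < β ∧
    MemLp h (ENNReal.ofReal (p / (p - 1))) (volume.restrict Ω) ∧
    ∀ᵐ x ∂(volume.restrict Ω), ∀ (s : ℝ) (ξ : E d),
      ‖a x s ξ‖ ≤ β * (h x + |s| ^ (p - 1) + ‖ξ‖ ^ (p - 1))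
  monotone : ∀ᵐ x ∂(volume.restrict Ω), ∀ (s : ℝ) (ξ η : E d), ξ ≠ η →
    0 < inner ℝ (a x s ξ - a x s η) (ξ - η)

/-- `u`, with `X`-gradient `U`, is a weak solution in `W₀^{1,p}(Ω, X)` of `X^* a(x, u, Xu) = X^* F`:
`∫_Ω a(x, u, Xu) · Xv = ∫_Ω F · Xv` for all `v ∈ W₀^{1,p}(Ω, X)`. -/
def IsWeakSolution (X : Fin d → E N → E N) (Ω : Set (E N)) (p : ℝ) (a : E N → ℝ → E d → E d)
    (F : E N → E d) (u : E N → ℝ) (U : E N → E d) : Prop :=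
  IsSobolevZero X Ω p u U ∧
    ∀ (v : E N → ℝ) (V : E N → E d), IsSobolevZero X Ω p v V →
      ∫ x in Ω, inner ℝ (a x (u x) (U x)) (V x) = ∫ x in Ω, inner ℝ (F x) (V x)

end XElliptic

end

/-! The proof is Stampacchia's level-set method at the critical exponent. The equation is tested
with `f(u)`, where `f` is a smooth truncation between two levels `k < h`; smoothness lets
composition with `f` preserve `C_c^∞(Ω)`. Coercivity and Hölder bound the `L^Q` norm of `f'(u) Xu`
by a constant times `|{u > k}|^ε`, with `ε > 0` because `m > Q'`.

Doubling makes `Q` play the role of the dimension, so a Sobolev bound in `L^∞` is not to be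
expected, but one with an arbitrarily small loss suffices: for `0 < θ ≤ 1` and measures `κ ≤
volume.restrict Ω`, `∫ |v| dκ ≤ K κ(univ)^(1 - θ/Q) ‖Xv‖_Q`. To prove it for test functions, means
over balls of radius `R/2^i` are telescoped; the Poincaré inequality bounds `|v(x)|` by a sum of
`R/2^i` times averages of `|Xv|`. The averaging at scale `i` maps `L^Q` to `L¹(κ)`. Its dual kernel
is bounded both by the doubling constant and by `κ(univ)` over the least volume of a ball;
interpolating between the two turns the sum into a geometric series of ratio `2^(-θ)`.

Taking `κ` carried by `{u > h}` gives `(h - k) |{u > h}| ≤ K |{u > k}|^(1 + ε - θ/Q)`. Once `θ/Q <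
ε` the power exceeds one, and Stampacchia's lemma makes some superlevel set null. The same argument
applies to `-u`. -/

/-! ### Subunit paths and the control distance. -/

/-- Absolute continuity is preserved by precomposition with a monotone or antitone `1`-Lipschitz
change of parameter. -/
theorem AbsolutelyContinuousOnInterval.comp_of_monotone_or_antitone {F : Type*}
    [PseudoMetricSpace F] {f : ℝ → F} {ρ : ℝ → ℝ} {a b c d : ℝ}
    (hf : AbsolutelyContinuousOnInterval f a b) (hρ : Monotone ρ ∨ Antitone ρ)
    (hρ1 : LipschitzWith 1 ρ) (hmaps : MapsTo ρ (uIcc c d) (uIcc a b)) :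
    AbsolutelyContinuousOnInterval (fun t => f (ρ t)) c d := by
  rw [absolutelyContinuousOnInterval_iff] at hf ⊢
  intro ε hε
  obtain ⟨δ, hδ, H⟩ := hf ε hε
  refine ⟨δ, hδ, fun E hE hlen => ?_⟩
  refine H (E.1, fun i => (ρ (E.2 i).1, ρ (E.2 i).2)) ⟨fun i hi => ?_, ?_⟩ ?_
  · exact ⟨hmaps (hE.1 i hi).1, hmaps (hE.1 i hi).2⟩
  · intro i hi j hj hij
    have := hE.2 hi hj hij
    simp only [Function.onFun, Set.disjoint_left] at this ⊢
    intro x hx hx'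
    -- If one parameter interval lay entirely to the left of the other, monotonicity would separate
    -- the images; a common image point therefore forces the parameter intervals to overlap.
    have key : ∀ s t : ℝ, x ∈ uIoc (ρ s) (ρ t) → ∀ s' t' : ℝ, x ∈ uIoc (ρ s') (ρ t') →
        min s t < max s' t' := by
      intro s t h s' t' h'
      by_contra hlt
      rw [not_lt] at hlt
      have h1 : s' ≤ s := (le_max_left _ _).trans (hlt.trans (min_le_left _ _))
      have h2 : s' ≤ t := (le_max_left _ _).trans (hlt.trans (min_le_right _ _))
      have h3 : t' ≤ s := (le_max_right _ _).trans (hlt.trans (min_le_left _ _))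
      have h4 : t' ≤ t := (le_max_right _ _).trans (hlt.trans (min_le_right _ _))
      rw [mem_uIoc] at h h'
      rcases hρ with m | m
      · have := m h1; have := m h2; have := m h3; have := m h4
        rcases h with h | h <;> rcases h' with h' | h' <;> linarith [h.1, h.2, h'.1, h'.2]
      · have := m h1; have := m h2; have := m h3; have := m h4
        rcases h with h | h <;> rcases h' with h' | h' <;> linarith [h.1, h.2, h'.1, h'.2]
    -- The smaller of the two right endpoints lies in both half-open intervals.
    refine this (a := min (max (E.2 i).1 (E.2 i).2) (max (E.2 j).1 (E.2 j).2)) ?_ ?_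
    · exact ⟨lt_min (key _ _ hx _ _ hx) (key _ _ hx _ _ hx'), min_le_left _ _⟩
    · exact ⟨lt_min (key _ _ hx' _ _ hx) (key _ _ hx' _ _ hx'), min_le_right _ _⟩
  · refine lt_of_le_of_lt (Finset.sum_le_sum fun i _ => ?_) hlen
    simpa using hρ1.dist_le_mul (E.2 i).1 (E.2 i).2

namespace XElliptic

variable {N d : ℕ} {X : Fin d → E N → E N} {Q : ℝ}

/-- Time reversal of a subunit path. -/
theorem IsSubunit.reverse {T : ℝ} {γ : ℝ → E N} (hT : 0 ≤ T) (h : IsSubunit X T γ) :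
    IsSubunit X T (fun t => γ (T - t)) := by
  obtain ⟨hac, θ, hθ⟩ := h
  refine ⟨hac.comp_of_monotone_or_antitone (ρ := fun t => T - t)
    (Or.inr fun s t hst => sub_le_sub_left hst T) ?_ ?_, fun t j => -θ (T - t) j, ?_⟩
  · refine LipschitzWith.of_dist_le_mul fun s t => ?_
    rw [NNReal.coe_one, one_mul, dist_sub_left]
  · intro t ht
    rw [uIcc_of_le hT] at ht ⊢
    exact ⟨by linarith [ht.2], by linarith [ht.1]⟩
  · rw [ae_restrict_iff' measurableSet_Icc] at hθ ⊢
    have := (Measure.measurePreserving_sub_left (volume : Measure ℝ) T).quasiMeasurePreserving.ae hθ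
    filter_upwards [this] with t ht htm
    obtain ⟨h1, h2⟩ := ht ⟨by linarith [htm.2], by linarith [htm.1]⟩
    refine ⟨?_, by simpa using h2⟩
    have h3 := HasDerivAt.scomp t h1 ((hasDerivAt_id t).const_sub T)
    simpa [Function.comp_def, Finset.sum_neg_distrib] using h3

/-- Concatenation of subunit paths. -/
theorem IsSubunit.concat {T₁ T₂ : ℝ} {γ₁ γ₂ : ℝ → E N} (hT₁ : 0 ≤ T₁) (hT₂ : 0 ≤ T₂)
    (h₁ : IsSubunit X T₁ γ₁) (h₂ : IsSubunit X T₂ γ₂) (h : γ₁ T₁ = γ₂ 0) :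
    IsSubunit X (T₁ + T₂) (fun t => γ₁ (min t T₁) + γ₂ (max (t - T₁) 0) - γ₂ 0) := by
  obtain ⟨hac₁, θ₁, hθ₁⟩ := h₁
  obtain ⟨hac₂, θ₂, hθ₂⟩ := h₂
  refine ⟨?_, fun t => if t < T₁ then θ₁ t else θ₂ (t - T₁), ?_⟩
  -- Clamping the time writes the concatenation as a sum of reparametrized paths and a constant, so
  -- absolute continuity needs no gluing argument.
  · have e₁ : AbsolutelyContinuousOnInterval (fun t => γ₁ (min t T₁)) 0 (T₁ + T₂) := by
      refine hac₁.comp_of_monotone_or_antitone (ρ := fun t => min t T₁)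
        (Or.inl fun s t hst => min_le_min_right _ hst) (LipschitzWith.id.min_const T₁) ?_
      intro t ht
      rw [uIcc_of_le (by linarith)] at ht
      rw [uIcc_of_le hT₁]
      exact ⟨le_min ht.1 hT₁, min_le_right _ _⟩
    have e₂ : AbsolutelyContinuousOnInterval (fun t => γ₂ (max (t - T₁) 0)) 0 (T₁ + T₂) := by
      refine hac₂.comp_of_monotone_or_antitone (ρ := fun t => max (t - T₁) 0)
        (Or.inl fun s t hst => max_le_max_right _ (by linarith)) ?_ ?_
      · exact (LipschitzWith.of_dist_le_mul fun s t => by simp).max_const 0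
      · intro t ht
        rw [uIcc_of_le (by linarith)] at ht
        rw [uIcc_of_le hT₂]
        exact ⟨le_max_right _ _, max_le (by linarith [ht.2]) hT₂⟩
    have e₃ : AbsolutelyContinuousOnInterval (fun _ : ℝ => γ₂ 0) 0 (T₁ + T₂) :=
      (LipschitzWith.const (γ₂ 0)).lipschitzOnWith.absolutelyContinuousOnInterval
    exact (e₁.add e₂).sub e₃
  · rw [ae_restrict_iff' measurableSet_Icc] at hθ₁ hθ₂ ⊢
    -- At the junction time the path may have a corner; a single time is negligible.
    have hne : ∀ᵐ t : ℝ, t ≠ T₁ := by simp [ae_iff]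
    filter_upwards [hθ₁, (measurePreserving_sub_right (volume : Measure ℝ)
      T₁).quasiMeasurePreserving.ae hθ₂, hne] with t h1 h2 hne htm
    rcases lt_or_gt_of_ne hne with hlt | hgt
    · obtain ⟨h3, h4⟩ := h1 ⟨htm.1, hlt.le⟩
      simp only [if_pos hlt, min_eq_left hlt.le, max_eq_right (sub_nonpos.2 hlt.le),
        add_sub_cancel_right]
      refine ⟨h3.congr_of_eventuallyEq ?_, h4⟩
      filter_upwards [Iio_mem_nhds hlt] with s hs
      rw [min_eq_left (le_of_lt hs), max_eq_right (sub_nonpos.2 (le_of_lt hs)),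
        add_sub_cancel_right]
    · obtain ⟨h3, h4⟩ := h2 ⟨by linarith, by linarith [htm.2]⟩
      simp only [if_neg (not_lt.2 hgt.le), min_eq_right hgt.le,
        max_eq_left (sub_nonneg.2 hgt.le), h, add_sub_cancel_left]
      refine ⟨?_, h4⟩
      have h5 := HasDerivAt.scomp t h3 ((hasDerivAt_id t).sub_const T₁)
      simp only [one_smul] at h5
      refine h5.congr_of_eventuallyEq ?_
      filter_upwards [Ioi_mem_nhds hgt] with s hs
      rw [min_eq_right (le_of_lt hs), max_eq_left (sub_nonneg.2 (le_of_lt hs)), h,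
        add_sub_cancel_left]
      rfl

theorem bddBelow_travelTimes (x y : E N) : BddBelow (travelTimes X x y) :=
  ⟨0, fun _ hT => hT.1.le⟩

theorem ccDist_nonneg (x y : E N) : 0 ≤ ccDist X x y :=
  Real.sInf_nonneg fun _ hT => hT.1.le

theorem ccDist_comm (x y : E N) : ccDist X x y = ccDist X y x := by
  have key : ∀ x y : E N, travelTimes X x y ⊆ travelTimes X y x := by
    rintro x y T ⟨hT, γ, hγ, h0, h1⟩
    exact ⟨hT, _, hγ.reverse hT.le, by simpa using h1, by simpa using h0⟩
  rw [ccDist, ccDist, (key x y).antisymm (key y x)]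

theorem ccDist_triangle (hX : IsXConnected X) (x y z : E N) :
    ccDist X x z ≤ ccDist X x y + ccDist X y z := by
  refine le_of_forall_pos_le_add fun ε hε => ?_
  -- Near-optimal times exist only for nonempty sets; the real infimum of the empty set is the
  -- default `0`.
  obtain ⟨T₁, ⟨hT₁, γ₁, hγ₁, h0₁, h1₁⟩, hlt₁⟩ :=
    Real.lt_sInf_add_pos (hX x y) (half_pos hε)
  obtain ⟨T₂, ⟨hT₂, γ₂, hγ₂, h0₂, h1₂⟩, hlt₂⟩ :=
    Real.lt_sInf_add_pos (hX y z) (half_pos hε)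
  have hmem : T₁ + T₂ ∈ travelTimes X x z := by
    refine ⟨by linarith, _, hγ₁.concat hT₁.le hT₂.le hγ₂ (h1₁.trans h0₂.symm), ?_, ?_⟩
    · simp [hT₁.le, h0₁]
    · simp [hT₂.le, h1₁, h0₂, h1₂]
  have := csInf_le (bddBelow_travelTimes x z) hmem
  change sInf _ ≤ sInf _ + sInf _ + ε
  linarith

/-! ### Topology and volume of control balls. -/

namespace IsAdmissible

/-- The triangle inequality reduces joint continuity to convergence at each of the two base points.
Joint continuity yields the measurability of `{δ < r}` in the product, needed for Tonelli. -/
theorem continuous_ccDist (hX : IsAdmissible X Q) :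
    Continuous (fun p : E N × E N => ccDist X p.1 p.2) := by
  refine continuous_iff_seqContinuous.2 fun p q hpq => ?_
  have h1 := (hX.tendsto_iff q.1 _).1 ((continuous_fst.tendsto q).comp hpq)
  have h2 := (hX.tendsto_iff q.2 _).1 ((continuous_snd.tendsto q).comp hpq)
  rw [tendsto_iff_dist_tendsto_zero]
  refine squeeze_zero (fun _ => dist_nonneg) (fun n => ?_) (by simpa using h1.add h2)
  simp only [Function.comp_apply, Real.dist_eq]
  have t := ccDist_triangle hX.connected
  rw [abs_le]
  constructor
  · linarith [t q.1 (p n).1 q.2, t (p n).1 (p n).2 q.2, ccDist_comm (X := X) (p n).2 q.2]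
  · linarith [t (p n).1 q.1 (p n).2, t q.1 q.2 (p n).2, ccDist_comm (X := X) (p n).1 q.1]

theorem isOpen_ccBall (hX : IsAdmissible X Q) (x : E N) (r : ℝ) : IsOpen (ccBall X x r) :=
  isOpen_lt (hX.continuous_ccDist.comp (by fun_prop : Continuous fun y : E N => (x, y)))
    continuous_const

theorem measurableSet_ccBall (hX : IsAdmissible X Q) (x : E N) (r : ℝ) :
    MeasurableSet (ccBall X x r) :=
  (hX.isOpen_ccBall x r).measurableSet

theorem measurableSet_ccDist_lt (hX : IsAdmissible X Q) (r : ℝ) :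
    MeasurableSet {p : E N × E N | ccDist X p.1 p.2 < r} :=
  (isOpen_lt hX.continuous_ccDist continuous_const).measurableSet

theorem volume_ccBall_pos (hX : IsAdmissible X Q) (x : E N) {r : ℝ} (hr : 0 < r) :
    0 < volume (ccBall X x r) := by
  simpa [mul_div_cancel₀] using (hX.doubling x (r / 2) (half_pos hr)).1

/-- Small control balls are contained in small Euclidean balls. -/
theorem exists_ccBall_subset (hX : IsAdmissible X Q) (x : E N) {U : Set (E N)} (hU : U ∈ 𝓝 x) :
    ∃ r : ℝ, 0 < r ∧ ccBall X x r ⊆ U := by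
  by_contra! H
  have H' : ∀ n : ℕ, ∃ y, y ∈ ccBall X x (1 / ((n : ℝ) + 1)) ∧ y ∉ U := fun n =>
    not_subset.1 (H _ (by positivity))
  choose y hy hyU using H'
  have : Tendsto y atTop (𝓝 x) := (hX.tendsto_iff x y).2 <|
    squeeze_zero (fun n => ccDist_nonneg _ _) (fun n => (hy n).le)
      tendsto_one_div_add_atTop_nhds_zero_nat
  obtain ⟨n, hn⟩ := (this.eventually hU).exists
  exact hyU n hn

theorem volume_ccBall_two_pow (hX : IsAdmissible X Q) (x : E N) {r : ℝ} (hr : 0 < r) (n : ℕ) :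
    volume (ccBall X x (2 ^ n * r)) ≤
      ENNReal.ofReal ((2 : ℝ) ^ Q) ^ n * volume (ccBall X x r) := by
  induction n with
  | zero => simp
  | succ n ih =>
    rw [pow_succ', mul_assoc, pow_succ', mul_assoc]
    exact (hX.doubling x _ (by positivity)).2.trans (by gcongr)

theorem ccBall_mono (x : E N) {r s : ℝ} (h : r ≤ s) : ccBall X x r ⊆ ccBall X x s :=
  fun _ hy => lt_of_lt_of_le hy h

/-- A control ball is not known to be bounded, but a small concentric one is, and finitely many
doublings reach the given radius. -/
theorem volume_ccBall_lt_top (hX : IsAdmissible X Q) (x : E N) (r : ℝ) :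
    volume (ccBall X x r) < ⊤ := by
  obtain ⟨ρ, hρ, hsub⟩ := hX.exists_ccBall_subset x (Metric.ball_mem_nhds x one_pos)
  obtain ⟨n, hn⟩ := pow_unbounded_of_one_lt (r / ρ) (one_lt_two : (1 : ℝ) < 2)
  have h1 : r ≤ 2 ^ n * ρ := ((div_lt_iff₀ hρ).1 hn).le
  calc volume (ccBall X x r) ≤ volume (ccBall X x (2 ^ n * ρ)) := measure_mono (ccBall_mono x h1)
    _ ≤ ENNReal.ofReal ((2 : ℝ) ^ Q) ^ n * volume (ccBall X x ρ) :=
      hX.volume_ccBall_two_pow x hρ n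
    _ < ⊤ := ENNReal.mul_lt_top (ENNReal.pow_lt_top ENNReal.ofReal_lt_top)
      ((measure_mono hsub).trans_lt measure_ball_lt_top)

theorem iUnion_ccBall (x : E N) : ⋃ n : ℕ, ccBall X x n = univ :=
  eq_univ_of_forall fun y => mem_iUnion.2 (exists_nat_gt (ccDist X x y))

/-- A bounded set lies in a control ball. -/
theorem exists_subset_ccBall (hX : IsAdmissible X Q) (x : E N) {s : Set (E N)}
    (hs : Bornology.IsBounded s) : ∃ R : ℝ, 0 < R ∧ s ⊆ ccBall X x R := by
  have hK : IsCompact (closure s) := hs.isCompact_closure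
  obtain ⟨M, hM⟩ := hK.bddAbove_image (f := fun y => ccDist X x y)
    (hX.continuous_ccDist.comp (by fun_prop : Continuous fun y : E N => (x, y))).continuousOn
  refine ⟨|M| + 1, by positivity, fun y hy => ?_⟩
  have := hM (mem_image_of_mem _ (subset_closure hy))
  exact lt_of_le_of_lt this (by linarith [le_abs_self M])

theorem ccBall_subset_ccBall (hX : IsAdmissible X Q) {x y : E N} {r s : ℝ}
    (h : ccDist X x y + r ≤ s) : ccBall X y r ⊆ ccBall X x s := fun z hz => by
  have h1 : ccDist X y z < r := hz
  have := ccDist_triangle hX.connected x y z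
  exact show ccDist X x z < s by linarith

/-- Balls of large radius centred at points of a bounded set have uniformly large volume. -/
theorem exists_forall_le_volume_ccBall (hX : IsAdmissible X Q) (hN : 0 < N) {s : Set (E N)}
    (hs : Bornology.IsBounded s) {c : ℝ≥0∞} (hc : c < ⊤) :
    ∃ R : ℝ, 0 < R ∧ ∀ r, R ≤ r → ∀ x ∈ s, c ≤ volume (ccBall X x r) := by
  have : Nonempty (Fin N) := ⟨⟨0, hN⟩⟩
  have : Nontrivial (E N) := inferInstance
  obtain ⟨R₀, hR₀, hsub⟩ := hX.exists_subset_ccBall 0 hs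
  have hmono : Monotone fun n : ℕ => ccBall X (0 : E N) n := fun m n hmn =>
    ccBall_mono 0 (Nat.cast_le.2 hmn)
  have ht := tendsto_measure_iUnion_atTop (μ := volume) hmono
  -- Positive dimension enters here: the space is noncompact, so the exhausting balls have volumes
  -- tending to infinity.
  rw [iUnion_ccBall, measure_univ_of_isAddLeftInvariant] at ht
  obtain ⟨n, hn⟩ := (ht.eventually (lt_mem_nhds hc)).exists
  refine ⟨n + R₀, by positivity, fun r hr x hx => hn.le.trans (measure_mono ?_)⟩
  refine hX.ccBall_subset_ccBall ?_
  have : ccDist X 0 x < R₀ := hsub hx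
  rw [ccDist_comm] at this
  linarith

end IsAdmissible
end XElliptic

/-! ### Pointwise bound by telescoping means. -/

namespace XElliptic

variable {N d : ℕ} {X : Fin d → E N → E N} {Q : ℝ}

/-- Serves with `c` the mean over a larger ball, to compare consecutive means, and with `c = u x`,
to pass to the limit. -/
theorem enorm_setAverage_sub_le {α : Type*} [MeasurableSpace α] {μ : Measure α} {s : Set α}
    (h0 : μ s ≠ 0) (hs : μ s ≠ ⊤) {u : α → ℝ} (hu : IntegrableOn u s μ) (c : ℝ) :
    ‖(⨍ z in s, u z ∂μ) - c‖ₑ ≤ ⨍⁻ y in s, ‖u y - c‖ₑ ∂μ := by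
  have : IsFiniteMeasure (μ.restrict s) := ⟨by simpa using hs.lt_top⟩
  have h1 : (⨍ z in s, u z ∂μ) - c = ⨍ z in s, (u z - c) ∂μ := by
    nth_rw 1 [← setAverage_const (μ := μ) h0 hs c]
    exact (integral_sub hu.to_average (integrable_const c).to_average).symm
  rw [h1]
  exact enorm_integral_le_lintegral_enorm _

/-- If `u` vanishes on at least half of `s`, its mean over `s` is controlled by its mean
oscillation. -/
theorem enorm_setAverage_le_of_eq_zero {α : Type*} [MeasurableSpace α] {μ : Measure α}
    {s Ω : Set α} (hΩ : MeasurableSet Ω) (hsm : MeasurableSet s) (hs : μ s ≠ ⊤)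
    (h2 : 2 * μ Ω ≤ μ s) {u : α → ℝ} (hu : ∀ x, x ∉ Ω → u x = 0) (c : ℝ) (h0 : μ s ≠ 0) :
    ‖c‖ₑ ≤ 2 * ⨍⁻ y in s, ‖u y - c‖ₑ ∂μ := by
  -- Off `Ω` the oscillation is exactly `‖c‖ₑ`, and `s \ Ω` carries at least half the measure of
  -- `s`.
  have h3 : ‖c‖ₑ * μ (s \ Ω) ≤ ∫⁻ y in s, ‖u y - c‖ₑ ∂μ := by
    calc ‖c‖ₑ * μ (s \ Ω) = ∫⁻ y in s \ Ω, ‖c‖ₑ ∂μ := by simp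
      _ = ∫⁻ y in s \ Ω, ‖u y - c‖ₑ ∂μ :=
        setLIntegral_congr_fun (hsm.diff hΩ) fun y hy => by simp [hu y hy.2]
      _ ≤ _ := lintegral_mono_set sdiff_subset
  have h4 : μ s ≤ 2 * μ (s \ Ω) := by
    have h5 : μ s ≤ μ Ω + μ (s \ Ω) := by
      calc μ s ≤ μ (Ω ∪ (s \ Ω)) := measure_mono (by simp)
        _ ≤ _ := measure_union_le _ _
    have h6 : μ Ω ≠ ⊤ := fun h => by simp [h] at h2; exact hs h2
    have h7 : μ s + 2 * μ Ω ≤ 2 * μ (s \ Ω) + 2 * μ Ω := by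
      calc μ s + 2 * μ Ω ≤ μ s + μ s := by gcongr
        _ = 2 * μ s := (two_mul _).symm
        _ ≤ 2 * (μ Ω + μ (s \ Ω)) := by gcongr
        _ = _ := by ring
    exact (ENNReal.add_le_add_iff_right (ENNReal.mul_ne_top ENNReal.ofNat_ne_top h6)).1 h7
  rw [setLAverage_eq, ← mul_div_assoc, ENNReal.le_div_iff_mul_le (Or.inl h0) (Or.inl hs)]
  calc ‖c‖ₑ * μ s ≤ ‖c‖ₑ * (2 * μ (s \ Ω)) := by gcongr
    _ = 2 * (‖c‖ₑ * μ (s \ Ω)) := by ring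
    _ ≤ _ := by gcongr

namespace IsAdmissible

theorem tendsto_setAverage_ccBall (hX : IsAdmissible X Q) {u : E N → ℝ} (hu : Continuous u)
    (hui : Integrable u) (x : E N) {r : ℕ → ℝ} (hr : ∀ i, 0 < r i)
    (hr0 : Tendsto r atTop (𝓝 0)) :
    Tendsto (fun i => ⨍ z in ccBall X x (r i), u z) atTop (𝓝 (u x)) := by
  rw [EMetric.tendsto_atTop]
  intro ε hε
  obtain ⟨δ, hδ, hδε⟩ := exists_between hε
  obtain ⟨ρ, hρ, hsub⟩ := hX.exists_ccBall_subset x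
    (hu.continuousAt.preimage_mem_nhds (Metric.eball_mem_nhds (u x) hδ))
  obtain ⟨n, hn⟩ := eventually_atTop.1 (hr0.eventually (gt_mem_nhds hρ))
  refine ⟨n, fun i hi => ?_⟩
  have h0 := (hX.volume_ccBall_pos x (hr i)).ne'
  have hs := (hX.volume_ccBall_lt_top x (r i)).ne
  rw [edist_eq_enorm_sub]
  refine lt_of_le_of_lt (enorm_setAverage_sub_le h0 hs hui.integrableOn _) (lt_of_le_of_lt ?_ hδε)
  rw [setLAverage_eq]
  refine ENNReal.div_le_of_le_mul ?_
  calc ∫⁻ y in ccBall X x (r i), ‖u y - u x‖ₑ ≤ ∫⁻ y in ccBall X x (r i), δ := by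
        refine setLIntegral_mono measurable_const fun y hy => ?_
        have : u y ∈ Metric.eball (u x) δ := hsub (ccBall_mono x (hn i hi).le hy)
        rw [← edist_eq_enorm_sub]
        exact (Metric.mem_eball.1 this).le
    _ = δ * volume (ccBall X x (r i)) := by simp

/-- Pointwise bound of a function vanishing outside a set of small measure by averages of its
`X`-gradient over shrinking control balls. -/
theorem enorm_le_tsum_laverage (hX : IsAdmissible X Q) {C ν : ℝ}
    (hP : ∀ (x : E N) (r : ℝ), 0 < r → ∀ u : E N → ℝ, ContDiff ℝ 1 u →
      IntegrableOn u (ccBall X x r) →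
      (⨍⁻ y in ccBall X x r, ‖u y - (⨍ z in ccBall X x r, u z ∂volume)‖ₑ ∂volume) ≤
        ENNReal.ofReal (C * r) * (⨍⁻ y in ccBall X x (ν * r), ‖xgrad X u y‖ₑ ∂volume))
    {Ω : Set (E N)} (hΩ : MeasurableSet Ω) {u : E N → ℝ} (hu : ContDiff ℝ 1 u)
    (hui : Integrable u) (hu0 : ∀ x, x ∉ Ω → u x = 0) {x : E N} {R : ℝ} (hR : 0 < R)
    (hR2 : 2 * volume Ω ≤ volume (ccBall X x R)) :
    ‖u x‖ₑ ≤ (ENNReal.ofReal ((2 : ℝ) ^ Q) + 2) * ∑' i : ℕ, ENNReal.ofReal (C * (R / 2 ^ i)) *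
      ⨍⁻ y in ccBall X x (ν * (R / 2 ^ i)), ‖xgrad X u y‖ₑ ∂volume := by
  set r : ℕ → ℝ := fun i => R / 2 ^ i with hrdef
  have hr : ∀ i, 0 < r i := fun i => by positivity
  have hrs : ∀ i, 2 * r (i + 1) = r i := fun i => by
    simp only [hrdef, pow_succ]; field_simp
  have hr0 : Tendsto r atTop (𝓝 0) := by
    have := (tendsto_pow_atTop_nhds_zero_of_lt_one (by norm_num : (0 : ℝ) ≤ 1 / 2)
      (by norm_num)).const_mul R
    simpa [hrdef, div_eq_mul_inv] using this
  set m : ℕ → ℝ := fun i => ⨍ z in ccBall X x (r i), u z with hm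
  set P : ℕ → ℝ≥0∞ := fun i => ENNReal.ofReal (C * r i) *
      ⨍⁻ y in ccBall X x (ν * r i), ‖xgrad X u y‖ₑ ∂volume with hPdef
  have hpos : ∀ i, volume (ccBall X x (r i)) ≠ 0 := fun i => (hX.volume_ccBall_pos x (hr i)).ne'
  have hfin : ∀ i, volume (ccBall X x (r i)) ≠ ⊤ := fun i => (hX.volume_ccBall_lt_top x _).ne
  have hosc : ∀ i, ⨍⁻ y in ccBall X x (r i), ‖u y - m i‖ₑ ∂volume ≤ P i := fun i =>
    hP x (r i) (hr i) u hu hui.integrableOn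
  -- Passing from a ball to the concentric ball of half the radius costs one doubling constant.
  have hstep : ∀ i, edist (m i) (m (i + 1)) ≤ ENNReal.ofReal ((2 : ℝ) ^ Q) * P i := fun i => by
    rw [edist_comm, edist_eq_enorm_sub]
    refine (enorm_setAverage_sub_le (hpos _) (hfin _) hui.integrableOn _).trans ?_
    refine le_trans ?_ (mul_le_mul_right (hosc i) _)
    rw [setLAverage_eq, setLAverage_eq]
    refine ENNReal.div_le_of_le_mul ?_
    have hd := (hX.doubling x _ (hr (i + 1))).2
    rw [hrs] at hd
    calc ∫⁻ y in ccBall X x (r (i + 1)), ‖u y - m i‖ₑ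
        ≤ ∫⁻ y in ccBall X x (r i), ‖u y - m i‖ₑ :=
          lintegral_mono_set (ccBall_mono x (by linarith [hrs i, hr (i + 1)]))
      _ = (∫⁻ y in ccBall X x (r i), ‖u y - m i‖ₑ) / volume (ccBall X x (r i)) *
            volume (ccBall X x (r i)) := (ENNReal.div_mul_cancel (hpos i) (hfin i)).symm
      _ ≤ (∫⁻ y in ccBall X x (r i), ‖u y - m i‖ₑ) / volume (ccBall X x (r i)) *
            (ENNReal.ofReal ((2 : ℝ) ^ Q) * volume (ccBall X x (r (i + 1)))) := by gcongr
      _ = _ := by ring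
  have hlim := hX.tendsto_setAverage_ccBall hu.continuous hui x hr hr0
  have h1 := edist_le_tsum_of_edist_le_of_tendsto₀ _ hstep hlim
  rw [ENNReal.tsum_mul_left] at h1
  -- The telescoping starts on a ball of which `Ω` fills at most half, so the first mean is itself
  -- an oscillation.
  have hm0 : ‖m 0‖ₑ ≤ 2 * P 0 := by
    refine (enorm_setAverage_le_of_eq_zero hΩ (hX.measurableSet_ccBall x (r 0)) (hfin 0) ?_ hu0
      (m 0) (hpos 0)).trans (mul_le_mul_right (hosc 0) _)
    simpa [hrdef] using hR2
  calc ‖u x‖ₑ = edist (u x) 0 := by simp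
    _ ≤ edist (u x) (m 0) + edist (m 0) 0 := edist_triangle _ _ _
    _ ≤ ENNReal.ofReal ((2 : ℝ) ^ Q) * ∑' i, P i + 2 * ∑' i, P i := by
      rw [edist_comm, edist_zero_right]
      exact add_le_add h1 (hm0.trans (mul_le_mul_right (ENNReal.le_tsum 0) _))
    _ = _ := by rw [add_mul]

end IsAdmissible
end XElliptic

/-! ### Sobolev inequality with a small loss. -/

namespace XElliptic

variable {N d : ℕ} {X : Fin d → E N → E N} {Q : ℝ}

theorem continuous_xgrad (hX : ∀ j, Continuous (X j)) {u : E N → ℝ} (hu : ContDiff ℝ 1 u) :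
    Continuous (xgrad X u) := by
  refine (PiLp.continuous_toLp 2 _).comp (continuous_pi fun j => ?_)
  exact (hu.continuous_fderiv one_ne_zero).clm_apply (hX j)

theorem xgrad_eq_zero_of_notMem_tsupport {u : E N → ℝ} {x : E N} (hx : x ∉ tsupport u) :
    xgrad X u x = 0 := by
  have : fderiv ℝ u x = 0 := by
    by_contra h
    exact hx (support_fderiv_subset ℝ h)
  ext j
  simp [xgrad, this]

namespace IsAdmissible

theorem continuous_vectorField (hX : IsAdmissible X Q) (j : Fin d) : Continuous (X j) :=
  (hX.locallyLipschitz j).continuous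

/-- Averaging over control balls of a fixed radius is bounded from `L^Q` to `L¹(κ)`, with a bound
interpolating between the one from the size of the balls and the one from doubling. -/
theorem lintegral_laverage_ccBall_le (hX : IsAdmissible X Q) (hQ : 1 < Q) {Ω : Set (E N)}
    (hΩ : MeasurableSet Ω) {κ : Measure (E N)} [IsFiniteMeasure κ] (hκ : κ ≤ volume.restrict Ω)
    {s : ℝ} (hs : 0 < s) {L : ℝ≥0∞} (hL : ∀ x ∈ Ω, L⁻¹ ≤ volume (ccBall X x s))
    {g : E N → ℝ≥0∞} (hg : Measurable g) {θ : ℝ} (hθ : 0 ≤ θ) (hθ1 : θ ≤ 1) :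
    ∫⁻ x, (⨍⁻ y in ccBall X x s, g y ∂volume) ∂κ ≤
      ((ENNReal.ofReal ((2 : ℝ) ^ Q)) ^ θ * (κ univ * L) ^ (1 - θ)) ^ (1 / Q) *
        κ univ ^ (1 - 1 / Q) * (∫⁻ y, g y ^ Q) ^ (1 / Q) := by
  set D := ENNReal.ofReal ((2 : ℝ) ^ Q) with hD
  set S : Set (E N × E N) := {p | ccDist X p.1 p.2 < s} with hS
  have hSm : MeasurableSet S := hX.measurableSet_ccDist_lt s
  set b : E N → ℝ≥0∞ := fun x => volume (ccBall X x s) with hb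
  have hbm : Measurable b := measurable_measure_prodMk_left hSm
  have hb0 : ∀ x, b x ≠ 0 := fun x => (hX.volume_ccBall_pos x hs).ne'
  have hbt : ∀ x, b x ≠ ⊤ := fun x => (hX.volume_ccBall_lt_top x s).ne
  set k : E N → E N → ℝ≥0∞ := fun x y => S.indicator (fun p => (b p.1)⁻¹) (x, y) with hk
  have hkm : Measurable (Function.uncurry k) :=
    (hbm.comp measurable_fst).inv.indicator hSm
  set w : E N → ℝ≥0∞ := fun y => ∫⁻ x, k x y ∂κ with hw
  have hwm : Measurable w := hkm.lintegral_prod_left'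
  have hκΩ : ∀ᵐ x ∂κ, x ∈ Ω := (Measure.absolutelyContinuous_of_le hκ).ae_le (ae_restrict_mem hΩ)
  have hkx : ∀ x, k x = (ccBall X x s).indicator (fun _ => (b x)⁻¹) := fun x => by
    ext y; rfl
  -- Tonelli moves the averaging onto `κ`: `w` is the dual kernel, and three bounds on it follow,
  -- two pointwise and one on its mass.
  have hswap : ∫⁻ x, (⨍⁻ y in ccBall X x s, g y ∂volume) ∂κ = ∫⁻ y, g y * w y := by
    have h1 : ∀ x, (⨍⁻ y in ccBall X x s, g y ∂volume) = ∫⁻ y, k x y * g y := fun x => by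
      rw [setLAverage_eq, ENNReal.div_eq_inv_mul,
        ← lintegral_const_mul _ hg, ← lintegral_indicator (hX.measurableSet_ccBall x s), hkx]
      refine lintegral_congr fun y => ?_
      by_cases hy : y ∈ ccBall X x s <;> simp [hy, hb]
    simp_rw [h1]
    rw [lintegral_lintegral_swap]
    · refine lintegral_congr fun y => ?_
      rw [lintegral_mul_const _ (hkm.of_uncurry_right), mul_comm]
    · exact (hkm.mul (hg.comp measurable_snd)).aemeasurable
  have hw1 : ∀ y, w y ≤ D := fun y => by
    calc w y ≤ ∫⁻ x, k x y := lintegral_mono' (hκ.trans Measure.restrict_le_self) le_rfl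
      _ ≤ ∫⁻ x, (ccBall X y s).indicator (fun _ => D * (b y)⁻¹) x := by
        refine lintegral_mono fun x => ?_
        by_cases hxy : x ∈ ccBall X y s
        · have hyx : y ∈ ccBall X x s := by
            change ccDist X x y < s
            rw [ccDist_comm]; exact hxy
          rw [hkx, indicator_of_mem hyx, indicator_of_mem hxy]
          -- The centres are exchanged: `B_s(y) ⊆ B_{2s}(x)`, then doubling.
          have h2 : b y ≤ D * b x := by
            refine (measure_mono (hX.ccBall_subset_ccBall (s := 2 * s) ?_)).trans
              (hX.doubling x s hs).2
            have : ccDist X x y < s := hyx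
            linarith
          rw [← div_eq_mul_inv, ENNReal.le_div_iff_mul_le (Or.inl (hb0 y)) (Or.inl (hbt y)),
            mul_comm, ← div_eq_mul_inv]
          exact ENNReal.div_le_of_le_mul h2
        · have hyx : y ∉ ccBall X x s := fun h => hxy (by
            change ccDist X y x < s
            rw [ccDist_comm]; exact h)
          simp [hkx, hyx]
      _ = D := by
        rw [lintegral_indicator_const (hX.measurableSet_ccBall y s), mul_assoc,
          ENNReal.inv_mul_cancel (hb0 y) (hbt y), mul_one]
  have hw2 : ∀ y, w y ≤ κ univ * L := fun y => by
    calc w y ≤ ∫⁻ _, L ∂κ := by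
          refine lintegral_mono_ae (hκΩ.mono fun x hx => ?_)
          rw [hkx]
          refine (indicator_le_self _ _ _).trans ?_
          exact ENNReal.inv_le_iff_inv_le.1 (hL x hx)
      _ = κ univ * L := by rw [lintegral_const, mul_comm]
  have hw3 : ∫⁻ y, w y ≤ κ univ := by
    rw [hw, lintegral_lintegral_swap (f := fun y x => k x y)
      (hkm.comp measurable_swap).aemeasurable]
    calc ∫⁻ x, (∫⁻ y, k x y) ∂κ ≤ ∫⁻ _, 1 ∂κ := by
          refine lintegral_mono fun x => ?_
          rw [hkx, lintegral_indicator_const (hX.measurableSet_ccBall x s)]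
          exact ENNReal.inv_mul_le_one _
      _ = κ univ := by simp
  set M := D ^ θ * (κ univ * L) ^ (1 - θ) with hM
  have hwM : ∀ y, w y ≤ M := fun y => by
    calc w y = w y ^ θ * w y ^ (1 - θ) := by
          rw [← ENNReal.rpow_add_of_nonneg _ _ hθ (by linarith), add_sub_cancel, ENNReal.rpow_one]
      _ ≤ M := by
        have : 0 ≤ 1 - θ := by linarith
        exact mul_le_mul' (ENNReal.rpow_le_rpow (hw1 y) hθ) (ENNReal.rpow_le_rpow (hw2 y) this)
  have hQ' : Q.HolderConjugate (Q / (Q - 1)) := Real.HolderConjugate.conjExponent hQ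
  have hQ1 : 0 < Q - 1 := by linarith
  -- Since `Q' = 1/(Q - 1) + 1`, one factor `w` is kept for the mass bound and the rest is estimated
  -- by the supremum `M`.
  have hpow : ∫⁻ y, w y ^ (Q / (Q - 1)) ≤ M ^ (1 / (Q - 1)) * κ univ := by
    calc ∫⁻ y, w y ^ (Q / (Q - 1)) ≤ ∫⁻ y, M ^ (1 / (Q - 1)) * w y := by
          refine lintegral_mono fun y => ?_
          have h3 : Q / (Q - 1) = 1 / (Q - 1) + 1 := by field_simp; ring
          rw [h3, ENNReal.rpow_add_of_nonneg _ _ (by positivity) zero_le_one, ENNReal.rpow_one]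
          gcongr
          exact hwM y
      _ = M ^ (1 / (Q - 1)) * ∫⁻ y, w y := lintegral_const_mul _ hwm
      _ ≤ _ := by gcongr
  rw [hswap]
  calc ∫⁻ y, g y * w y
      ≤ (∫⁻ y, g y ^ Q) ^ (1 / Q) * (∫⁻ y, w y ^ (Q / (Q - 1))) ^ (1 / (Q / (Q - 1))) :=
        ENNReal.lintegral_mul_le_Lp_mul_Lq _ hQ' hg.aemeasurable hwm.aemeasurable
    _ ≤ (∫⁻ y, g y ^ Q) ^ (1 / Q) * (M ^ (1 / (Q - 1)) * κ univ) ^ (1 / (Q / (Q - 1))) := by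
        gcongr
    _ = _ := by
      have h4 : 1 / (Q / (Q - 1)) = 1 - 1 / Q := by field_simp
      have h5 : 1 / (Q - 1) * (1 - 1 / Q) = 1 / Q := by field_simp
      have h6 : 0 ≤ 1 - 1 / Q := by rw [← h4]; positivity
      rw [h4, ENNReal.mul_rpow_of_nonneg _ _ h6, ← ENNReal.rpow_mul, h5]
      ring

/-- A Sobolev-type inequality for test functions: integrability of `φ` beyond `L¹`, in the form of
a power gain in the total mass of `κ`. -/
theorem exists_lintegral_le_of_isTestFunction (hX : IsAdmissible X Q) (hN : 0 < N) (hQ : 1 < Q)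
    {Ω : Set (E N)} (hΩ : IsOpen Ω) (hΩb : Bornology.IsBounded Ω) {θ : ℝ} (hθ : 0 < θ)
    (hθ1 : θ ≤ 1) :
    ∃ K : ℝ≥0∞, K ≠ ⊤ ∧ ∀ φ, IsTestFunction Ω φ → ∀ κ ≤ volume.restrict Ω,
      ∫⁻ x, ‖φ x‖ₑ ∂κ ≤ K * κ univ ^ (1 - θ / Q) *
        eLpNorm (xgrad X φ) (ENNReal.ofReal Q) (volume.restrict Ω) := by
  obtain ⟨C, ν, hC, hν, hP⟩ := hX.poincare
  have hQ0 : 0 < Q := by linarith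
  have hΩfin : volume Ω < ⊤ := hΩb.measure_lt_top
  -- The summand `2 * volume Ω` serves the first mean of the telescoping; the summand `1` normalizes
  -- the lower bound `D^(-i)` for the volumes of the balls of radius `νR/2^i`.
  obtain ⟨R₁, hR₁, hvol⟩ := hX.exists_forall_le_volume_ccBall hN hΩb
    (c := 2 * volume Ω + 1) (ENNReal.add_lt_top.2 ⟨ENNReal.mul_lt_top (by simp) hΩfin, by simp⟩)
  obtain ⟨R, hR, hRR, hνR⟩ : ∃ R : ℝ, 0 < R ∧ R₁ ≤ R ∧ R₁ ≤ ν * R := by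
    refine ⟨max R₁ (R₁ / ν), lt_max_of_lt_left hR₁, le_max_left _ _, ?_⟩
    rw [← div_le_iff₀' hν]
    exact le_max_right _ _
  set D := ENNReal.ofReal ((2 : ℝ) ^ Q) with hD
  have hD2 : D = (2 : ℝ≥0∞) ^ Q := by
    rw [hD, ← ENNReal.ofReal_rpow_of_pos (by norm_num)]; simp
  have hDQ : D ^ (1 / Q) = 2 := by
    rw [hD2, ← ENNReal.rpow_mul, mul_one_div_cancel hQ0.ne', ENNReal.rpow_one]
  -- The radius contributes `1/2` per scale and the averaging operator `D^((1 - θ)/Q) = 2^(1 - θ)`.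
  -- Summability is exactly `θ > 0`.
  set ρ : ℝ≥0∞ := 2⁻¹ * 2 ^ (1 - θ) with hρ
  have hρ1 : ρ < 1 := by
    have : ρ = 2 ^ (-θ) := by
      rw [hρ, ← ENNReal.rpow_neg_one, ← ENNReal.rpow_add _ _ (by simp) (by simp)]
      congr 1; ring
    rw [this]
    exact ENNReal.rpow_lt_one_of_one_lt_of_neg (by simp) (by linarith)
  refine ⟨(D + 2) * (ENNReal.ofReal (C * R) * 2 ^ θ * (1 - ρ)⁻¹), ?_, fun φ hφ κ hκ => ?_⟩
  · have h1 : (1 - ρ)⁻¹ ≠ ⊤ := ENNReal.inv_ne_top.2 (tsub_pos_of_lt hρ1).ne'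
    have h2 : (2 : ℝ≥0∞) ^ θ ≠ ⊤ := ENNReal.rpow_ne_top_of_nonneg hθ.le (by simp)
    have h3 : D + 2 ≠ ⊤ := by simp [hD]
    exact ENNReal.mul_ne_top h3 (ENNReal.mul_ne_top (ENNReal.mul_ne_top (by simp) h2) h1)
  have : Fact (volume Ω < ⊤) := ⟨hΩfin⟩
  have : IsFiniteMeasure κ := isFiniteMeasure_of_le _ hκ
  have hκΩ : ∀ᵐ x ∂κ, x ∈ Ω :=
    (Measure.absolutelyContinuous_of_le hκ).ae_le (ae_restrict_mem hΩ.measurableSet)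
  have hφ1 : ContDiff ℝ 1 φ := hφ.1.of_le (by exact_mod_cast le_top)
  have hφi : Integrable φ := hφ1.continuous.integrable_of_hasCompactSupport hφ.2.1
  have hφ0 : ∀ x, x ∉ Ω → φ x = 0 := fun x hx => image_eq_zero_of_notMem_tsupport
    fun h => hx (hφ.2.2 h)
  set g : E N → ℝ≥0∞ := fun y => ‖xgrad X φ y‖ₑ with hg
  have hgm : Measurable g := (continuous_xgrad hX.continuous_vectorField hφ1).measurable.enorm
  set G := eLpNorm (xgrad X φ) (ENNReal.ofReal Q) (volume.restrict Ω) with hG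
  have hGg : (∫⁻ y, g y ^ Q) ^ (1 / Q) = G := by
    rw [hG, eLpNorm_restrict_eq_of_support_subset, eLpNorm_eq_lintegral_rpow_enorm_toReal
      (by simpa using hQ0) (by simp), ENNReal.toReal_ofReal hQ0.le]
    intro x hx
    by_contra h
    exact hx (xgrad_eq_zero_of_notMem_tsupport fun h' => h (hφ.2.2 h'))
  have hterm : ∀ i : ℕ, ∫⁻ x, (⨍⁻ y in ccBall X x (ν * (R / 2 ^ i)), g y ∂volume) ∂κ ≤
      2 ^ θ * (2 ^ (1 - θ)) ^ i * κ univ ^ (1 - θ / Q) * G := fun i => by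
    refine (hX.lintegral_laverage_ccBall_le hQ hΩ.measurableSet hκ (L := D ^ i) (by positivity)
      (fun x hx => ?_) hgm hθ.le hθ1).trans (le_of_eq ?_)
    · have h1 := hX.volume_ccBall_two_pow x (r := ν * (R / 2 ^ i)) (by positivity) i
      have h2 : (2 : ℝ) ^ i * (ν * (R / 2 ^ i)) = ν * R := by field_simp
      rw [h2] at h1
      have h3 : 1 ≤ D ^ i * volume (ccBall X x (ν * (R / 2 ^ i))) :=
        (le_add_self.trans (hvol _ hνR x hx)).trans h1
      rw [mul_comm] at h3
      simpa [one_div] using ENNReal.div_le_of_le_mul h3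
    · have hθ' : 0 ≤ 1 - θ := by linarith
      have hQi : 0 ≤ 1 / Q := by positivity
      have hQi1 : 1 / Q ≤ 1 := by rw [div_le_one hQ0]; exact hQ.le
      rw [hGg, ENNReal.mul_rpow_of_nonneg _ _ hQi, ← ENNReal.rpow_mul, mul_comm θ,
        ENNReal.rpow_mul, hDQ, ← ENNReal.rpow_mul, ENNReal.mul_rpow_of_nonneg _ _ (by positivity),
        mul_comm (1 - θ), ENNReal.rpow_mul (D ^ i), ← ENNReal.rpow_natCast D,
        ← ENNReal.rpow_mul D, mul_comm (i : ℝ), ENNReal.rpow_mul D, hDQ, ← ENNReal.rpow_mul 2,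
        mul_comm (i : ℝ), ENNReal.rpow_mul 2, ENNReal.rpow_natCast]
      have h4 : 1 - θ / Q = 1 / Q * (1 - θ) + (1 - 1 / Q) := by field_simp; ring
      rw [h4, ENNReal.rpow_add_of_nonneg _ _ (by positivity) (by linarith)]
      ring
  have hmeas : ∀ s : ℝ, Measurable fun x => ⨍⁻ y in ccBall X x s, g y ∂volume := fun s => by
    have hSm := hX.measurableSet_ccDist_lt s
    have h1 : Measurable fun x => volume (ccBall X x s) := measurable_measure_prodMk_left hSm
    have h2 : Measurable fun x => ∫⁻ y in ccBall X x s, g y := by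
      have h3 : ∀ x, ∫⁻ y in ccBall X x s, g y =
          ∫⁻ y, {p : E N × E N | ccDist X p.1 p.2 < s}.indicator (fun p => g p.2) (x, y) :=
        fun x => by
          rw [← lintegral_indicator (hX.measurableSet_ccBall x s)]
          rfl
      simp_rw [h3]
      exact ((hgm.comp measurable_snd).indicator hSm).lintegral_prod_right'
    simp_rw [setLAverage_eq]
    exact h2.div h1
  calc ∫⁻ x, ‖φ x‖ₑ ∂κ
      ≤ ∫⁻ x, (D + 2) * ∑' i : ℕ, ENNReal.ofReal (C * (R / 2 ^ i)) *
          (⨍⁻ y in ccBall X x (ν * (R / 2 ^ i)), g y ∂volume) ∂κ := by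
        refine lintegral_mono_ae (hκΩ.mono fun x hx => ?_)
        exact hX.enorm_le_tsum_laverage hP hΩ.measurableSet hφ1 hφi hφ0 hR
          (le_self_add.trans (hvol R hRR x hx))
    _ = (D + 2) * ∑' i : ℕ, ENNReal.ofReal (C * (R / 2 ^ i)) *
          ∫⁻ x, (⨍⁻ y in ccBall X x (ν * (R / 2 ^ i)), g y ∂volume) ∂κ := by
        rw [lintegral_const_mul _ (Measurable.tsum fun i => (hmeas _).const_mul _),
          lintegral_tsum fun i => ((hmeas _).const_mul _).aemeasurable]
        simp_rw [lintegral_const_mul _ (hmeas _)]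
    _ ≤ (D + 2) * ∑' i : ℕ, (ENNReal.ofReal (C * R) * 2 ^ θ * κ univ ^ (1 - θ / Q) * G) *
          ρ ^ i := by
        refine mul_le_mul_right (ENNReal.tsum_le_tsum fun i => ?_) _
        refine (mul_le_mul_right (hterm i) _).trans (le_of_eq ?_)
        have h5 : ENNReal.ofReal (C * (R / 2 ^ i)) = ENNReal.ofReal (C * R) * 2⁻¹ ^ i := by
          rw [← mul_div_assoc, ENNReal.ofReal_div_of_pos (by positivity),
            ENNReal.ofReal_pow (by norm_num), div_eq_mul_inv, ENNReal.inv_pow,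
            ENNReal.ofReal_ofNat]
        rw [h5, hρ, mul_pow]
        ring
    _ = _ := by
        rw [ENNReal.tsum_mul_left, ENNReal.tsum_geometric]
        ring

/-- The Sobolev-type inequality in `W₀^{1,Q}(Ω, X)`. -/
theorem exists_lintegral_le_of_isSobolevZero (hX : IsAdmissible X Q) (hN : 0 < N) (hQ : 1 < Q)
    {Ω : Set (E N)} (hΩ : IsOpen Ω) (hΩb : Bornology.IsBounded Ω) {θ : ℝ} (hθ : 0 < θ)
    (hθ1 : θ ≤ 1) :
    ∃ K : ℝ≥0∞, K ≠ ⊤ ∧ ∀ v V, IsSobolevZero X Ω Q v V → ∀ κ ≤ volume.restrict Ω,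
      ∫⁻ x, ‖v x‖ₑ ∂κ ≤ K * κ univ ^ (1 - θ / Q) *
        eLpNorm V (ENNReal.ofReal Q) (volume.restrict Ω) := by
  obtain ⟨K, hK, H⟩ := hX.exists_lintegral_le_of_isTestFunction hN hQ hΩ hΩb hθ hθ1
  refine ⟨K, hK, fun v V ⟨_, hV, φ, hφ, h1, h2⟩ κ hκ => ?_⟩
  have hQ1 : 1 ≤ ENNReal.ofReal Q := by simpa using ENNReal.ofReal_le_ofReal hQ.le
  have : Fact (volume Ω < ⊤) := ⟨hΩb.measure_lt_top⟩
  have : IsFiniteMeasure κ := isFiniteMeasure_of_le _ hκ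
  have hexp : 0 ≤ 1 - θ / Q := by
    have : θ / Q ≤ 1 := by rw [div_le_one (by linarith)]; linarith
    linarith
  set c := K * κ univ ^ (1 - θ / Q) with hc
  have hcfin : c ≠ ⊤ :=
    ENNReal.mul_ne_top hK (ENNReal.rpow_ne_top_of_nonneg hexp (measure_ne_top _ _))
  -- The estimate for `φ n` is applied to `v = φ n - (φ n - v)`; the remainder is small in `L¹(κ)`
  -- because `κ` is dominated by Lebesgue measure on `Ω`.
  have hlim : Tendsto (fun n => c * (eLpNorm (xgrad X (φ n) - V) (ENNReal.ofReal Q)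
      (volume.restrict Ω) + eLpNorm V (ENNReal.ofReal Q) (volume.restrict Ω)) +
      eLpNorm (φ n - v) 1 (volume.restrict Ω)) atTop
      (𝓝 (c * (0 + eLpNorm V (ENNReal.ofReal Q) (volume.restrict Ω)) + 0)) :=
    (ENNReal.Tendsto.const_mul (h2.add tendsto_const_nhds) (Or.inr hcfin)).add h1
  rw [zero_add, add_zero] at hlim
  refine ge_of_tendsto' hlim fun n => ?_
  have hφ1 : ContDiff ℝ 1 (φ n) := (hφ n).1.of_le (by exact_mod_cast le_top)
  have hXm := (continuous_xgrad hX.continuous_vectorField hφ1).aestronglyMeasurable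
    (μ := volume.restrict Ω)
  calc ∫⁻ x, ‖v x‖ₑ ∂κ ≤ ∫⁻ x, (‖φ n x‖ₑ + ‖(φ n - v) x‖ₑ) ∂κ := by
        refine lintegral_mono fun x => ?_
        have : v x = φ n x - (φ n - v) x := by simp
        conv_lhs => rw [this]
        exact enorm_sub_le
    _ = ∫⁻ x, ‖φ n x‖ₑ ∂κ + ∫⁻ x, ‖(φ n - v) x‖ₑ ∂κ :=
        lintegral_add_left hφ1.continuous.measurable.enorm _
    _ ≤ c * eLpNorm (xgrad X (φ n)) (ENNReal.ofReal Q) (volume.restrict Ω) +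
          eLpNorm (φ n - v) 1 (volume.restrict Ω) := by
        refine add_le_add (H _ (hφ n) κ hκ) ?_
        rw [eLpNorm_one_eq_lintegral_enorm]
        exact lintegral_mono' hκ le_rfl
    _ ≤ _ := by
        gcongr
        have : xgrad X (φ n) = (xgrad X (φ n) - V) + V := by simp
        conv_lhs => rw [this]
        exact eLpNorm_add_le (hXm.sub hV.1) hV.1 hQ1

end IsAdmissible
end XElliptic

/-! ### Chain rule and Carathéodory compositions. -/

/-- Dominated convergence in `Lᵖ`, for products `cₙ • g` with uniformly bounded scalars. -/
theorem MeasureTheory.tendsto_eLpNorm_smul_of_bounded {α G : Type*} [MeasurableSpace α]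
    {μ : Measure α} [NormedAddCommGroup G] [NormedSpace ℝ G] {p : ℝ≥0∞} (hp0 : p ≠ 0)
    (hp : p ≠ ⊤) {g : α → G} (hg : MemLp g p μ) {c : ℕ → α → ℝ} {K : ℝ}
    (hcm : ∀ n, AEStronglyMeasurable (c n) μ) (hc : ∀ n x, |c n x| ≤ K)
    (hlim : ∀ᵐ x ∂μ, Tendsto (fun n => c n x) atTop (𝓝 0)) :
    Tendsto (fun n => eLpNorm (fun x => c n x • g x) p μ) atTop (𝓝 0) := by
  have hpt : 0 < p.toReal := ENNReal.toReal_pos hp0 hp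
  simp_rw [eLpNorm_eq_lintegral_rpow_enorm_toReal hp0 hp]
  have key : Tendsto (fun n => ∫⁻ x, ‖c n x • g x‖ₑ ^ p.toReal ∂μ) atTop (𝓝 (∫⁻ _, 0 ∂μ)) := by
    refine tendsto_lintegral_of_dominated_convergence'
      (fun x => (ENNReal.ofReal K * ‖g x‖ₑ) ^ p.toReal)
      (fun n => (((hcm n).smul hg.1).enorm).pow_const _)
      (fun n => Eventually.of_forall fun x => ?_) ?_ ?_
    · simp only [enorm_smul]
      gcongr
      rw [Real.enorm_eq_ofReal_abs]
      exact ENNReal.ofReal_le_ofReal (hc n x)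
    · simp_rw [ENNReal.mul_rpow_of_nonneg _ _ hpt.le]
      rw [lintegral_const_mul'' _ (hg.1.enorm.pow_const _)]
      refine ENNReal.mul_ne_top (ENNReal.rpow_ne_top_of_nonneg hpt.le (by simp)) ?_
      exact (lintegral_rpow_enorm_lt_top_of_eLpNorm_lt_top hp0 hp hg.2).ne
    · filter_upwards [hlim] with x hx
      have h1 : Tendsto (fun n => ‖c n x • g x‖ₑ) atTop (𝓝 0) := by
        have := (hx.smul_const (g x)).enorm
        simpa using this
      have h2 := h1.ennrpow_const p.toReal
      rwa [ENNReal.zero_rpow_of_pos hpt] at h2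
  rw [lintegral_zero] at key
  have := key.ennrpow_const (1 / p.toReal)
  rwa [ENNReal.zero_rpow_of_pos (by positivity)] at this

/-- Composition of a Carathéodory function with a measurable function. -/
theorem MeasureTheory.aestronglyMeasurable_of_caratheodory {α Z G : Type*} [MeasurableSpace α]
    {μ : Measure α} [TopologicalSpace Z] [NormedAddCommGroup G] {b : α → Z → G}
    (hb : ∀ z, AEStronglyMeasurable (fun x => b x z) μ) (hc : ∀ᵐ x ∂μ, Continuous (b x))
    {z : α → Z} (hz : AEStronglyMeasurable z μ) :
    AEStronglyMeasurable (fun x => b x (z x)) μ := by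
  classical
  have hs : ∀ s : SimpleFunc α Z, AEStronglyMeasurable (fun x => b x (s x)) μ := fun s => by
    have h1 : (fun x => b x (s x)) =
        fun x => ∑ c ∈ s.range, (s ⁻¹' {c}).indicator (fun x => b x c) x := by
      ext x
      rw [Finset.sum_eq_single (s x)]
      · simp
      · intro c _ hcx
        exact indicator_of_notMem (fun h => hcx (by simpa using h.symm)) _
      · intro h
        exact absurd (s.mem_range_self x) h
    rw [h1]
    exact Finset.aestronglyMeasurable_fun_sum _ fun c _ =>
      (hb c).indicator (s.measurableSet_fiber c)
  refine aestronglyMeasurable_of_tendsto_ae atTop (f := fun n x =>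
    b x (hz.stronglyMeasurable_mk.approx n x)) (fun n => hs _) ?_
  filter_upwards [hc, hz.ae_eq_mk] with x hx hzx
  rw [hzx]
  exact (hx.tendsto _).comp (hz.stronglyMeasurable_mk.tendsto_approx x)

namespace XElliptic

variable {N d : ℕ} {X : Fin d → E N → E N}

theorem xgrad_comp {f : ℝ → ℝ} {φ : E N → ℝ} (hf : Differentiable ℝ f)
    (hφ : Differentiable ℝ φ) (x : E N) :
    xgrad X (f ∘ φ) x = deriv f (φ x) • xgrad X φ x := by
  ext j
  have h := ((hf (φ x)).hasDerivAt.comp_hasFDerivAt x (hφ x).hasFDerivAt).fderiv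
  simp [xgrad, h]

theorem IsTestFunction.comp {Ω : Set (E N)} {f : ℝ → ℝ} {φ : E N → ℝ} (hφ : IsTestFunction Ω φ)
    (hf : ContDiff ℝ ∞ f) (hf0 : f 0 = 0) : IsTestFunction Ω (f ∘ φ) :=
  ⟨hf.comp hφ.1, hφ.2.1.comp_left hf0, (tsupport_comp_subset hf0 _).trans hφ.2.2⟩

/-- The chain rule in `W₀^{1,p}(Ω, X)` for a smooth `1`-Lipschitz function vanishing at `0`. -/
theorem IsSobolevZero.comp {Ω : Set (E N)} {p : ℝ} {u : E N → ℝ} {U : E N → E d}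
    (hX : ∀ j, Continuous (X j)) (hp : 1 ≤ p) (h : IsSobolevZero X Ω p u U) {f : ℝ → ℝ}
    (hf : ContDiff ℝ ∞ f) (hf0 : f 0 = 0) (hf1 : ∀ t, |deriv f t| ≤ 1) :
    IsSobolevZero X Ω p (fun x => f (u x)) (fun x => deriv f (u x) • U x) := by
  obtain ⟨hu, hU, φ, hφ, h1, h2⟩ := h
  have hp1 : 1 ≤ ENNReal.ofReal p := by simpa using ENNReal.ofReal_le_ofReal hp
  have hp0 : ENNReal.ofReal p ≠ 0 := (zero_lt_one.trans_le hp1).ne'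
  have hlip : LipschitzWith 1 f :=
    lipschitzWith_of_nnnorm_deriv_le (hf.differentiable (by simp)) fun t => by
      rw [← NNReal.coe_le_coe]; simpa using hf1 t
  have hdist : ∀ s t, ‖f s - f t‖ ≤ ‖s - t‖ := fun s t => by
    simpa [dist_eq_norm] using hlip.dist_le_mul s t
  have hdf : Continuous (deriv f) := hf.continuous_deriv (by simp)
  have hφc : ∀ n, ContDiff ℝ 1 (φ n) := fun n => (hφ n).1.of_le (by exact_mod_cast le_top)
  have hφm : ∀ n, AEStronglyMeasurable (φ n) (volume.restrict Ω) := fun n =>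
    (hφc n).continuous.aestronglyMeasurable
  have hcU : AEStronglyMeasurable (fun x => deriv f (u x)) (volume.restrict Ω) :=
    hdf.comp_aestronglyMeasurable hu.1
  -- A subsequence converging almost everywhere is needed for `f'(φ) → f'(u)`.
  obtain ⟨ns, hns, hae⟩ := (tendstoInMeasure_of_tendsto_eLpNorm one_ne_zero hφm hu.1
    h1).exists_seq_tendsto_ae
  refine ⟨hu.mono (hf.continuous.comp_aestronglyMeasurable hu.1) (Eventually.of_forall fun x => ?_),
    hU.mono (hcU.smul hU.1) (Eventually.of_forall fun x => ?_),
    fun k => f ∘ φ (ns k), fun k => (hφ _).comp hf hf0, ?_, ?_⟩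
  · simpa [hf0] using hdist (u x) 0
  · rw [norm_smul]
    exact mul_le_of_le_one_left (norm_nonneg _) (hf1 _)
  · refine tendsto_of_tendsto_of_tendsto_of_le_of_le tendsto_const_nhds
      (h1.comp hns.tendsto_atTop) (fun _ => zero_le) fun k => ?_
    exact eLpNorm_mono fun x => hdist (φ (ns k) x) (u x)
  -- The error splits as `f'(φ)(Xφ - U) + (f'(φ) - f'(u))U`; dominated convergence handles the
  -- second term, with `2` bounding the difference of two slopes.
  · have h3 := tendsto_eLpNorm_smul_of_bounded hp0 ENNReal.ofReal_ne_top hU (K := 2)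
      (c := fun k x => deriv f (φ (ns k) x) - deriv f (u x))
      (fun k => (hdf.comp_aestronglyMeasurable (hφm _)).sub hcU)
      (fun k x => by
        have a1 := hf1 (φ (ns k) x)
        have a2 := hf1 (u x)
        rw [abs_le] at *
        constructor <;> linarith [a1.1, a1.2, a2.1, a2.2])
      (hae.mono fun x hx => by
        have := ((hdf.tendsto (u x)).comp hx).sub_const (deriv f (u x))
        simpa using this)
    have h4 := (h2.comp hns.tendsto_atTop).add h3
    rw [add_zero] at h4
    refine tendsto_of_tendsto_of_tendsto_of_le_of_le tendsto_const_nhds h4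
      (fun _ => zero_le) fun k => ?_
    have hXm := ((continuous_xgrad hX (hφc (ns k))).aestronglyMeasurable
      (μ := volume.restrict Ω)).sub hU.1
    have h5 : xgrad X (f ∘ φ (ns k)) - (fun x => deriv f (u x) • U x) =
        (fun x => deriv f (φ (ns k) x) • (xgrad X (φ (ns k)) - U) x) +
          fun x => (deriv f (φ (ns k) x) - deriv f (u x)) • U x := by
      ext1 x
      simp only [Pi.sub_apply, Pi.add_apply, sub_smul, smul_sub]
      rw [xgrad_comp (hf.differentiable (by simp)) ((hφc _).differentiable one_ne_zero)]
      abel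
    dsimp only
    rw [h5]
    refine (eLpNorm_add_le ((hdf.comp_aestronglyMeasurable (hφm _)).smul hXm)
      (((hdf.comp_aestronglyMeasurable (hφm _)).sub hcU).smul hU.1) hp1).trans ?_
    refine add_le_add (eLpNorm_mono fun x => ?_) le_rfl
    rw [Pi.smul_apply', norm_smul]
    exact mul_le_of_le_one_left (norm_nonneg _) (hf1 _)

end XElliptic

/-! ### Energy estimates. -/

namespace XElliptic

variable {N d : ℕ} {X : Fin d → E N → E N} {Q : ℝ}

theorem IsLerayLions.aestronglyMeasurable_comp {Ω : Set (E N)} {a : E N → ℝ → E d → E d}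
    (ha : IsLerayLions Ω Q a) {u : E N → ℝ} {U : E N → E d}
    (hu : AEStronglyMeasurable u (volume.restrict Ω))
    (hU : AEStronglyMeasurable U (volume.restrict Ω)) :
    AEStronglyMeasurable (fun x => a x (u x) (U x)) (volume.restrict Ω) :=
  aestronglyMeasurable_of_caratheodory (b := fun x (z : ℝ × E d) => a x z.1 z.2)
    (fun z => ha.caratheodory.1 z.1 z.2) ha.caratheodory.2 (hu.prodMk hU)

/-- `a(x, u, U) · c U` is integrable if the bounded function `c` lives where `u` is bounded. -/
theorem IsLerayLions.integrable_inner_smul {Ω : Set (E N)} (hΩb : Bornology.IsBounded Ω)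
    (hQ : 1 < Q) {a : E N → ℝ → E d → E d} (ha : IsLerayLions Ω Q a) {u : E N → ℝ}
    {U : E N → E d} (hu : AEStronglyMeasurable u (volume.restrict Ω))
    (hU : MemLp U (ENNReal.ofReal Q) (volume.restrict Ω)) {c : ℝ → ℝ} (hc : Continuous c)
    (hc1 : ∀ t, |c t| ≤ 1) {H : ℝ} (hcH : ∀ t, c t ≠ 0 → |t| ≤ H) :
    IntegrableOn (fun x => inner ℝ (a x (u x) (U x)) (c (u x) • U x)) Ω := by
  obtain ⟨β, h, hβ, hh, hgrow⟩ := ha.growth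
  have hQ1 : 1 ≤ ENNReal.ofReal Q := by simpa using ENNReal.ofReal_le_ofReal hQ.le
  have hQ0 : 0 < Q := by linarith
  have : Fact (volume Ω < ⊤) := ⟨hΩb.measure_lt_top⟩
  have i1 : Integrable (fun x => ‖h x‖ * ‖U x‖) (volume.restrict Ω) := by
    have hconj : (ENNReal.ofReal (Q / (Q - 1))).HolderConjugate (ENNReal.ofReal Q) :=
      (Real.HolderConjugate.conjExponent hQ).symm.ennrealOfReal
    exact hh.norm.integrable_mul hU.norm
  have i2 : Integrable (fun x => |H| ^ (Q - 1) * ‖U x‖) (volume.restrict Ω) :=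
    (hU.integrable hQ1).norm.const_mul _
  have i3 : Integrable (fun x => ‖U x‖ ^ Q) (volume.restrict Ω) := by
    have := hU.integrable_norm_rpow (by simpa using hQ0) (by simp)
    simpa [ENNReal.toReal_ofReal hQ0.le] using this
  refine (((i1.add i2).add i3).const_mul β).mono' ?_ ?_
  · exact (ha.aestronglyMeasurable_comp hu hU.1).inner
      ((hc.comp_aestronglyMeasurable hu).smul hU.1)
  · filter_upwards [hgrow] with x hx
    simp only [Pi.add_apply]
    by_cases hcx : c (u x) = 0
    · simp only [hcx, zero_smul, inner_zero_right, norm_zero]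
      positivity
    · have hUQ : ‖U x‖ ^ Q = ‖U x‖ ^ (Q - 1) * ‖U x‖ := by
        rw [← Real.rpow_add_one' (norm_nonneg _) (by linarith), sub_add_cancel]
      -- By definition `u` is only in `L¹`, so the term `|u|^(Q-1)` is controlled through the
      -- cutoff.
      have huH : |u x| ^ (Q - 1) ≤ |H| ^ (Q - 1) :=
        Real.rpow_le_rpow (abs_nonneg _) ((hcH _ hcx).trans (le_abs_self H)) (by linarith)
      calc ‖inner ℝ (a x (u x) (U x)) (c (u x) • U x)‖
          ≤ ‖a x (u x) (U x)‖ * ‖c (u x) • U x‖ := norm_inner_le_norm _ _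
        _ ≤ (β * (‖h x‖ + |H| ^ (Q - 1) + ‖U x‖ ^ (Q - 1))) * ‖U x‖ := by
          refine mul_le_mul ((hx (u x) (U x)).trans ?_) ?_ (norm_nonneg _) (by positivity)
          · gcongr
            exact Real.le_norm_self _
          · rw [norm_smul]
            exact mul_le_of_le_one_left (norm_nonneg _) (hc1 _)
        _ = _ := by rw [hUQ]; ring

/-- The energy estimate obtained by testing the equation with `f(u)`, where `f` is smooth,
nondecreasing, `1`-Lipschitz and `f'` is supported in a bounded part of `S`. -/
theorem IsWeakSolution.energy_le {Ω : Set (E N)} (hΩb : Bornology.IsBounded Ω) (hQ : 1 < Q)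
    (hX : ∀ j, Continuous (X j)) {a : E N → ℝ → E d → E d} (ha : IsLerayLions Ω Q a) {α : ℝ}
    (hα : ∀ᵐ x ∂(volume.restrict Ω), ∀ (s : ℝ) (ξ : E d), α * ‖ξ‖ ^ Q ≤ inner ℝ (a x s ξ) ξ)
    (hα0 : 0 < α) {F : E N → E d} (hF : AEStronglyMeasurable F (volume.restrict Ω))
    {u : E N → ℝ} {U : E N → E d}
    (hu : IsWeakSolution X Ω Q a F u U) {f : ℝ → ℝ} (hf : ContDiff ℝ ∞ f) (hf0 : f 0 = 0)
    (hf' : ∀ t, 0 ≤ deriv f t) (hf1 : ∀ t, deriv f t ≤ 1) {H : ℝ}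
    (hfH : ∀ t, deriv f t ≠ 0 → |t| ≤ H) {S : Set ℝ} (hS : MeasurableSet S)
    (hfS : ∀ t, deriv f t ≠ 0 → t ∈ S) :
    ENNReal.ofReal α * eLpNorm (fun x => deriv f (u x) • U x) (ENNReal.ofReal Q)
        (volume.restrict Ω) ^ Q ≤
      eLpNorm F (ENNReal.ofReal (Q / (Q - 1))) ((volume.restrict Ω).restrict (u ⁻¹' S)) *
        eLpNorm (fun x => deriv f (u x) • U x) (ENNReal.ofReal Q) (volume.restrict Ω) := by
  obtain ⟨hsob, heq⟩ := hu
  have hum := hsob.1.1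
  have hU := hsob.2.1
  set μ := volume.restrict Ω with hμ
  set V : E N → E d := fun x => deriv f (u x) • U x with hV
  have habs : ∀ t, |deriv f t| ≤ 1 := fun t => by rw [abs_of_nonneg (hf' t)]; exact hf1 t
  have hfV : IsSobolevZero X Ω Q (fun x => f (u x)) V := hsob.comp hX hQ.le hf hf0 habs
  have hQ0 : 0 < Q := by linarith
  have hQm1 : 0 < Q - 1 := by linarith
  have hQe : ENNReal.ofReal Q ≠ 0 := by simpa using hQ0
  have hQ'0 : 0 < Q / (Q - 1) := by positivity
  have hdf : Continuous (deriv f) := hf.continuous_deriv (by simp)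
  have hVQ : eLpNorm V (ENNReal.ofReal Q) μ ^ Q = ∫⁻ x, ‖V x‖ₑ ^ Q ∂μ := by
    rw [eLpNorm_eq_lintegral_rpow_enorm_toReal hQe (by simp), ENNReal.toReal_ofReal hQ0.le,
      ← ENNReal.rpow_mul, one_div_mul_cancel hQ0.ne', ENNReal.rpow_one]
  -- Without integrability the Bochner integral in the equation would be the default `0` and give no
  -- bound.
  have hint := ha.integrable_inner_smul hΩb hQ hum hU hdf habs hfH
  have hlow : ∀ᵐ x ∂μ, α * ‖V x‖ ^ Q ≤ inner ℝ (a x (u x) (U x)) (V x) := by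
    filter_upwards [hα] with x hx
    have h1 := hx (u x) (U x)
    -- Slopes in `[0, 1]` decrease under powers above one, so coercivity at `U` controls the energy
    -- of `f(u)`.
    have h2 : deriv f (u x) ^ Q ≤ deriv f (u x) := by
      simpa using Real.rpow_le_rpow_of_exponent_ge' (hf' (u x)) (hf1 (u x)) zero_le_one hQ.le
    simp only [hV]
    rw [norm_smul, real_inner_smul_right, Real.norm_of_nonneg (hf' _),
      Real.mul_rpow (hf' _) (norm_nonneg _)]
    calc α * (deriv f (u x) ^ Q * ‖U x‖ ^ Q) ≤ α * (deriv f (u x) * ‖U x‖ ^ Q) := by gcongr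
      _ = deriv f (u x) * (α * ‖U x‖ ^ Q) := by ring
      _ ≤ _ := mul_le_mul_of_nonneg_left h1 (hf' _)
  have hpos : ∀ᵐ x ∂μ, 0 ≤ inner ℝ (a x (u x) (U x)) (V x) :=
    hlow.mono fun x hx => le_trans (by positivity) hx
  have hVS : ∀ x, x ∉ u ⁻¹' S → V x = 0 := fun x hx => by
    by_contra hne
    exact hx (hfS _ fun h0 => hne (by simp [hV, h0]))
  have hSn : NullMeasurableSet (u ⁻¹' S) μ := hum.aemeasurable.nullMeasurableSet_preimage hS
  calc ENNReal.ofReal α * eLpNorm V (ENNReal.ofReal Q) μ ^ Q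
      = ∫⁻ x, ENNReal.ofReal (α * ‖V x‖ ^ Q) ∂μ := by
        rw [hVQ, ← lintegral_const_mul'' _ (hfV.2.1.1.enorm.pow_const _)]
        refine lintegral_congr fun x => ?_
        rw [ENNReal.ofReal_mul hα0.le, ← ENNReal.ofReal_rpow_of_nonneg (norm_nonneg _) hQ0.le,
          ofReal_norm]
    _ ≤ ∫⁻ x, ENNReal.ofReal (inner ℝ (a x (u x) (U x)) (V x)) ∂μ :=
        lintegral_mono_ae (hlow.mono fun x hx => ENNReal.ofReal_le_ofReal hx)
    _ = ENNReal.ofReal (∫ x, inner ℝ (a x (u x) (U x)) (V x) ∂μ) :=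
        (ofReal_integral_eq_lintegral_ofReal hint hpos).symm
    _ = ENNReal.ofReal (∫ x, inner ℝ (F x) (V x) ∂μ) := by rw [heq _ _ hfV]
    _ ≤ ‖∫ x, inner ℝ (F x) (V x) ∂μ‖ₑ := by
        rw [Real.enorm_eq_ofReal_abs]
        exact ENNReal.ofReal_le_ofReal (le_abs_self _)
    _ ≤ ∫⁻ x, ‖(inner ℝ (F x) (V x) : ℝ)‖ₑ ∂μ := enorm_integral_le_lintegral_enorm _
    _ ≤ ∫⁻ x, (u ⁻¹' S).indicator (fun x => ‖F x‖ₑ * ‖V x‖ₑ) x ∂μ := by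
        refine lintegral_mono fun x => ?_
        by_cases hx : x ∈ u ⁻¹' S
        · rw [indicator_of_mem hx, ← ofReal_norm, ← ofReal_norm,
            ← ofReal_norm, ← ENNReal.ofReal_mul (norm_nonneg _)]
          exact ENNReal.ofReal_le_ofReal (norm_inner_le_norm _ _)
        · simp [hVS x hx]
    _ = ∫⁻ x in u ⁻¹' S, ‖F x‖ₑ * ‖V x‖ₑ ∂μ := lintegral_indicator₀ hSn _
    _ ≤ (∫⁻ x in u ⁻¹' S, ‖F x‖ₑ ^ (Q / (Q - 1)) ∂μ) ^ (1 / (Q / (Q - 1))) *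
          (∫⁻ x in u ⁻¹' S, ‖V x‖ₑ ^ Q ∂μ) ^ (1 / Q) :=
        ENNReal.lintegral_mul_le_Lp_mul_Lq _ (Real.HolderConjugate.conjExponent hQ).symm
          hF.restrict.enorm hfV.2.1.1.restrict.enorm
    _ ≤ _ := by
        rw [eLpNorm_eq_lintegral_rpow_enorm_toReal (by simpa using hQ'0) (by simp),
          eLpNorm_eq_lintegral_rpow_enorm_toReal hQe (by simp), ENNReal.toReal_ofReal hQ0.le,
          ENNReal.toReal_ofReal hQ'0.le]
        gcongr
        exact Measure.restrict_le_self

/-- Decay of the energy of `f(u)` in terms of the measure of the level set carrying `f'(u)`. -/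
theorem IsWeakSolution.exists_eLpNorm_le {Ω : Set (E N)} (hΩb : Bornology.IsBounded Ω)
    (hQ : 1 < Q) (hX : ∀ j, Continuous (X j)) {a : E N → ℝ → E d → E d}
    (ha : IsLerayLions Ω Q a) {m : ℝ≥0∞} (hm : ENNReal.ofReal (Q / (Q - 1)) < m)
    {F : E N → E d} (hF : MemLp F m (volume.restrict Ω)) {u : E N → ℝ} {U : E N → E d}
    (hu : IsWeakSolution X Ω Q a F u U) :
    ∃ ε : ℝ, 0 < ε ∧ ∃ K : ℝ≥0∞, K ≠ ⊤ ∧ ∀ f : ℝ → ℝ, ContDiff ℝ ∞ f → f 0 = 0 →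
      (∀ t, 0 ≤ deriv f t) → (∀ t, deriv f t ≤ 1) → (∃ H : ℝ, ∀ t, deriv f t ≠ 0 → |t| ≤ H) →
      ∀ S : Set ℝ, MeasurableSet S → (∀ t, deriv f t ≠ 0 → t ∈ S) →
      eLpNorm (fun x => deriv f (u x) • U x) (ENNReal.ofReal Q) (volume.restrict Ω) ≤
        K * volume.restrict Ω (u ⁻¹' S) ^ ε := by
  obtain ⟨α, hα0, hα⟩ := ha.coercive
  have hQ0 : 0 < Q := by linarith
  have hQm1 : 0 < Q - 1 := by linarith
  have hQ'0 : 0 < Q / (Q - 1) := by positivity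
  -- This is the Hölder gain `1/Q' - 1/m`. For `m = ⊤` the conventions `⊤.toReal = 0` and `1 / 0 =
  -- 0` give the correct value.
  have hε : 0 < 1 / (Q / (Q - 1)) - 1 / m.toReal := by
    rcases eq_or_ne m ⊤ with rfl | hmt
    · simp only [ENNReal.toReal_top, div_zero, sub_zero]; positivity
    · have : Q / (Q - 1) < m.toReal := (ENNReal.ofReal_lt_iff_lt_toReal hQ'0.le hmt).1 hm
      exact sub_pos.2 (one_div_lt_one_div_of_lt hQ'0 this)
  set ε := 1 / (Q / (Q - 1)) - 1 / m.toReal with hεdef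
  refine ⟨ε / (Q - 1), by positivity,
    ((ENNReal.ofReal α)⁻¹ * eLpNorm F m (volume.restrict Ω)) ^ (1 / (Q - 1)), ?_, ?_⟩
  · refine ENNReal.rpow_ne_top_of_nonneg (by positivity) (ENNReal.mul_ne_top ?_ hF.2.ne)
    exact ENNReal.inv_ne_top.2 (by simpa using hα0)
  · rintro f hf hf0 hf' hf1 ⟨H, hfH⟩ S hS hfS
    have key := hu.energy_le hΩb hQ hX ha hα hα0 hF.1 hf hf0 hf' hf1 hfH hS hfS
    have hVfin : eLpNorm (fun x => deriv f (u x) • U x) (ENNReal.ofReal Q)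
        (volume.restrict Ω) ≠ ⊤ :=
      (hu.1.comp hX hQ.le hf hf0 fun t => by
        rw [abs_of_nonneg (hf' t)]; exact hf1 t).2.1.2.ne
    set e := eLpNorm (fun x => deriv f (u x) • U x) (ENNReal.ofReal Q) (volume.restrict Ω)
    rcases eq_or_ne e 0 with he | he
    · simp [he]
    have hFS : eLpNorm F (ENNReal.ofReal (Q / (Q - 1)))
        ((volume.restrict Ω).restrict (u ⁻¹' S)) ≤
          eLpNorm F m (volume.restrict Ω) * volume.restrict Ω (u ⁻¹' S) ^ ε := by
      refine (eLpNorm_le_eLpNorm_mul_rpow_measure_univ hm.le hF.1.restrict).trans ?_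
      rw [Measure.restrict_apply_univ, ENNReal.toReal_ofReal hQ'0.le]
      exact mul_le_mul_left (eLpNorm_mono_measure _ Measure.restrict_le_self) _
    have hαt : ENNReal.ofReal α ≠ 0 := by simpa using hα0
    have h1 : e ^ (Q - 1) ≤ (ENNReal.ofReal α)⁻¹ * eLpNorm F m (volume.restrict Ω) *
        volume.restrict Ω (u ⁻¹' S) ^ ε := by
      have h2 : e ^ Q = e ^ (Q - 1) * e := by
        conv_lhs => rw [← sub_add_cancel Q 1]
        rw [ENNReal.rpow_add _ _ he hVfin, ENNReal.rpow_one]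
      rw [h2, ← mul_assoc, ENNReal.mul_le_mul_iff_left he hVfin] at key
      rw [mul_assoc, mul_comm (ENNReal.ofReal α)⁻¹, ← div_eq_mul_inv,
        ENNReal.le_div_iff_mul_le (Or.inl hαt) (Or.inl ENNReal.ofReal_ne_top), mul_comm]
      exact key.trans hFS
    calc e = (e ^ (Q - 1)) ^ (1 / (Q - 1)) := by
          rw [← ENNReal.rpow_mul, mul_one_div_cancel hQm1.ne', ENNReal.rpow_one]
      _ ≤ _ := ENNReal.rpow_le_rpow h1 (by positivity)
      _ = _ := by
          rw [ENNReal.mul_rpow_of_nonneg _ _ (by positivity), ← ENNReal.rpow_mul, mul_one_div]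

end XElliptic

/-! ### Level-set iteration and smooth truncations. -/

/-- Stampacchia's lemma: a nonincreasing function with superlinear level decay vanishes at some
finite level. -/
theorem exists_eq_zero_of_stampacchia {φ : ℝ → ℝ} (h0 : ∀ k, 0 ≤ φ k) (hφ : Antitone φ) {K η : ℝ}
    (hK : 0 ≤ K) (hη : 0 < η)
    (H : ∀ k h, 0 ≤ k → k < h → (h - k) * φ h ≤ K * φ k ^ (1 + η)) : ∃ k, φ k = 0 := by
  -- With levels `M(1 - 2^(-n))` the gaps halve, so the decay rate must satisfy `q^η = 1/2`. The
  -- induction closes when `2 K φ(0)^η ≤ M q`, which dictates `M`; the added `1` keeps it positive.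
  set q : ℝ := (1 / 2) ^ (1 / η) with hq
  have hq0 : 0 < q := by positivity
  have hq1 : q < 1 := Real.rpow_lt_one (by norm_num) (by norm_num) (by positivity)
  have hqη : q ^ η = 1 / 2 := by
    rw [hq, ← Real.rpow_mul (by norm_num), one_div_mul_cancel hη.ne', Real.rpow_one]
  set M : ℝ := 2 * K * φ 0 ^ η / q + 1 with hM
  have hφη : 0 ≤ φ 0 ^ η := Real.rpow_nonneg (h0 0) _
  have hM0 : 0 < M := by positivity
  have hMq : 2 * K * φ 0 ^ η ≤ M * q := by
    rw [hM, add_mul, div_mul_cancel₀ _ hq0.ne']; linarith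
  have key : ∀ n : ℕ, φ (M * (1 - (1 / 2) ^ n)) ≤ φ 0 * q ^ n := by
    intro n
    induction n with
    | zero => simp
    | succ n ih =>
      have hp : (0 : ℝ) < (1 / 2) ^ n := by positivity
      have hp1 : ((1 : ℝ) / 2) ^ n ≤ 1 := pow_le_one₀ (by norm_num) (by norm_num)
      have h1 := H (M * (1 - (1 / 2) ^ n)) (M * (1 - (1 / 2) ^ (n + 1)))
        (mul_nonneg hM0.le (by linarith))
        (mul_lt_mul_of_pos_left (by rw [pow_succ]; linarith) hM0)
      have h2 : M * (1 - (1 / 2) ^ (n + 1)) - M * (1 - (1 / 2) ^ n) = M * (1 / 2) ^ n / 2 := by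
        rw [pow_succ]; ring
      rw [h2] at h1
      have h3 : φ (M * (1 - (1 / 2) ^ n)) ^ (1 + η) ≤ φ 0 * φ 0 ^ η * q ^ n * (1 / 2) ^ n := by
        calc φ (M * (1 - (1 / 2) ^ n)) ^ (1 + η) ≤ (φ 0 * q ^ n) ^ (1 + η) :=
              Real.rpow_le_rpow (h0 _) ih (by linarith)
          _ = _ := by
            have hpos : 0 ≤ φ 0 * q ^ n := mul_nonneg (h0 0) (by positivity)
            rw [add_comm, Real.rpow_add_one' hpos (by linarith),
              Real.mul_rpow (h0 0) (by positivity), ← Real.rpow_natCast q n,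
              ← Real.rpow_mul hq0.le, mul_comm (n : ℝ), Real.rpow_mul hq0.le, hqη,
              Real.rpow_natCast, Real.rpow_natCast]
            ring
      have h4 : (M * (1 / 2) ^ n / 2) * φ (M * (1 - (1 / 2) ^ (n + 1))) ≤
          (M * (1 / 2) ^ n / 2) * (φ 0 * q ^ (n + 1)) := by
        calc _ ≤ K * (φ 0 * φ 0 ^ η * q ^ n * (1 / 2) ^ n) :=
              h1.trans (mul_le_mul_of_nonneg_left h3 hK)
          _ = (2 * K * φ 0 ^ η) * (φ 0 * q ^ n * (1 / 2) ^ n / 2) := by ring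
          _ ≤ (M * q) * (φ 0 * q ^ n * (1 / 2) ^ n / 2) := by
            refine mul_le_mul_of_nonneg_right hMq ?_
            have := h0 0
            positivity
          _ = _ := by rw [pow_succ q]; ring
      exact le_of_mul_le_mul_left h4 (by positivity)
  refine ⟨M, le_antisymm ?_ (h0 M)⟩
  have hlim : Tendsto (fun n : ℕ => φ 0 * q ^ n) atTop (𝓝 (φ 0 * 0)) :=
    (tendsto_pow_atTop_nhds_zero_of_lt_one hq0.le hq1).const_mul _
  rw [mul_zero] at hlim
  refine ge_of_tendsto' hlim fun n => (hφ ?_).trans (key n)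
  have hp : (0 : ℝ) < (1 / 2) ^ n := by positivity
  exact mul_le_of_le_one_right hM0.le (by linarith)

/-- A smooth transition from `0` to a positive constant with slope between `0` and `1`. -/
theorem exists_smooth_ramp : ∃ (ψ : ℝ → ℝ) (c : ℝ), 0 < c ∧ ContDiff ℝ ∞ ψ ∧
    (∀ t ≤ 0, ψ t = 0) ∧ (∀ t, 1 ≤ t → ψ t = c) ∧ (∀ t, 0 ≤ deriv ψ t) ∧ (∀ t, deriv ψ t ≤ 1) ∧
    ∀ t, deriv ψ t ≠ 0 → t ∈ Ioo 0 1 := by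
  have hsm : ContDiff ℝ ∞ Real.smoothTransition := Real.smoothTransition.contDiff
  have hd : Differentiable ℝ Real.smoothTransition := hsm.differentiable (by simp)
  -- Outside the open interval every point is a global minimum or maximum, endpoints included.
  have hsupp : ∀ t, deriv Real.smoothTransition t ≠ 0 → t ∈ Ioo (0 : ℝ) 1 := by
    intro t ht
    by_contra hmem
    rw [mem_Ioo, not_and_or, not_lt, not_lt] at hmem
    refine ht (hmem.elim (fun h => IsLocalMin.deriv_eq_zero ?_)
      fun h => IsLocalMax.deriv_eq_zero ?_)
    · refine Eventually.of_forall fun s => ?_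
      rw [Real.smoothTransition.zero_of_nonpos h]
      exact Real.smoothTransition.nonneg s
    · refine Eventually.of_forall fun s => ?_
      rw [Real.smoothTransition.one_of_one_le h]
      exact Real.smoothTransition.le_one s
  obtain ⟨B, hB⟩ := (isCompact_Icc (a := (0 : ℝ)) (b := 1)).exists_bound_of_continuousOn
    (hsm.continuous_deriv (by simp)).continuousOn
  have hBd : ∀ t, deriv Real.smoothTransition t ≤ |B| := fun t => by
    by_cases h : deriv Real.smoothTransition t = 0
    · rw [h]; exact abs_nonneg _
    · exact (Real.le_norm_self _).trans ((hB t (Ioo_subset_Icc_self (hsupp t h))).trans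
        (le_abs_self _))
  have hder : ∀ t, deriv (fun t => (|B| + 1)⁻¹ * Real.smoothTransition t) t =
      (|B| + 1)⁻¹ * deriv Real.smoothTransition t := fun t => deriv_const_mul _ (hd t)
  have hB1 : 0 < |B| + 1 := by positivity
  refine ⟨fun t => (|B| + 1)⁻¹ * Real.smoothTransition t, (|B| + 1)⁻¹, by positivity,
    contDiff_const.mul hsm, fun t ht => ?_, fun t ht => ?_, fun t => ?_, fun t => ?_,
    fun t ht => ?_⟩
  · simp [Real.smoothTransition.zero_of_nonpos ht]
  · simp [Real.smoothTransition.one_of_one_le ht]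
  · rw [hder]
    exact mul_nonneg (by positivity) Real.smoothTransition.monotone.deriv_nonneg
  · rw [hder, inv_mul_le_iff₀ hB1]
    linarith [hBd t]
  · refine hsupp t fun h => ht ?_
    rw [hder, h, mul_zero]

/-- Smooth approximate truncations between the levels `k < h`, on either side of `0`. -/
theorem exists_smooth_truncation : ∃ c : ℝ, 0 < c ∧ ∀ σ k h : ℝ, σ ^ 2 = 1 → 0 ≤ k → k < h →
    ∃ f : ℝ → ℝ, ContDiff ℝ ∞ f ∧ f 0 = 0 ∧ (∀ t, 0 ≤ deriv f t) ∧ (∀ t, deriv f t ≤ 1) ∧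
      (∀ t, deriv f t ≠ 0 → |t| ≤ h) ∧ (∀ t, deriv f t ≠ 0 → k < σ * t) ∧
      ∀ t, h < σ * t → |f t| = c * (h - k) := by
  obtain ⟨ψ, c, hc, hψ, hψ0, hψ1, hψ', hψ'1, hsupp⟩ := exists_smooth_ramp
  refine ⟨c, hc, fun σ k h hσ hk hkh => ?_⟩
  have hhk : 0 < h - k := sub_pos.2 hkh
  have hσabs : |σ| = 1 := by
    have := sq_abs σ
    rw [hσ] at this
    exact (pow_eq_one_iff_of_nonneg (abs_nonneg _) two_ne_zero).1 this
  -- The amplitude `h - k` cancels the inner scaling, and `σ² = 1` makes the slope nonnegative on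
  -- either side of `0`.
  have hder : ∀ t, deriv (fun t => σ * (h - k) * ψ ((σ * t - k) / (h - k))) t =
      deriv ψ ((σ * t - k) / (h - k)) := fun t => by
    have h1 : HasDerivAt (fun t => (σ * t - k) / (h - k)) (σ * 1 / (h - k)) t :=
      (((hasDerivAt_id t).const_mul σ).sub_const k).div_const _
    have h2 := ((hψ.differentiable (by simp) ((σ * t - k) / (h - k))).hasDerivAt.comp t
      h1).const_mul (σ * (h - k))
    refine h2.deriv.trans ?_
    calc σ * (h - k) * (deriv ψ ((σ * t - k) / (h - k)) * (σ * 1 / (h - k)))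
        = σ ^ 2 * deriv ψ ((σ * t - k) / (h - k)) := by field_simp
      _ = _ := by rw [hσ, one_mul]
  refine ⟨fun t => σ * (h - k) * ψ ((σ * t - k) / (h - k)), ?_, ?_, fun t => ?_, fun t => ?_,
    fun t ht => ?_, fun t ht => ?_, fun t ht => ?_⟩
  · exact contDiff_const.mul
      (hψ.comp (((contDiff_const.mul contDiff_id).sub contDiff_const).div_const _))
  · have : (σ * 0 - k) / (h - k) ≤ 0 := div_nonpos_of_nonpos_of_nonneg (by linarith) hhk.le
    exact mul_eq_zero_of_right _ (hψ0 _ this)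
  · rw [hder]; exact hψ' _
  · rw [hder]; exact hψ'1 _
  · rw [hder] at ht
    obtain ⟨h1, h2⟩ := hsupp _ ht
    rw [div_lt_one hhk] at h2
    rw [div_pos_iff_of_pos_right hhk] at h1
    have : |σ * t| = |t| := by rw [abs_mul, hσabs, one_mul]
    rw [← this, abs_of_nonneg (by linarith)]
    linarith
  · rw [hder] at ht
    have h1 := (hsupp _ ht).1
    rw [div_pos_iff_of_pos_right hhk] at h1
    linarith
  · have h1 : 1 ≤ (σ * t - k) / (h - k) := by rw [one_le_div hhk]; linarith
    simp only [hψ1 _ h1, abs_mul, hσabs, one_mul, abs_of_pos hhk, abs_of_pos hc]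
    ring

/-! ### Boundedness of weak solutions. -/

namespace XElliptic

variable {N d : ℕ} {X : Fin d → E N → E N} {Q : ℝ}

/-- One-sided boundedness of weak solutions: above (`σ = 1`) or below (`σ = -1`). -/
theorem IsWeakSolution.exists_measure_superlevel_eq_zero (hX : IsAdmissible X Q) (hN : 0 < N)
    (hQ : 1 < Q) {Ω : Set (E N)} (hΩ : IsOpen Ω) (hΩb : Bornology.IsBounded Ω)
    {a : E N → ℝ → E d → E d} (ha : IsLerayLions Ω Q a) {m : ℝ≥0∞}
    (hm : ENNReal.ofReal (Q / (Q - 1)) < m) {F : E N → E d}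
    (hF : MemLp F m (volume.restrict Ω)) {u : E N → ℝ} {U : E N → E d}
    (hu : IsWeakSolution X Ω Q a F u U) {σ : ℝ} (hσ : σ ^ 2 = 1) :
    ∃ k : ℝ, volume.restrict Ω {x | k < σ * u x} = 0 := by
  have hQ0 : 0 < Q := by linarith
  have : Fact (volume Ω < ⊤) := ⟨hΩb.measure_lt_top⟩
  obtain ⟨ε, hε, K₁, hK₁, hen⟩ :=
    hu.exists_eLpNorm_le hΩb hQ hX.continuous_vectorField ha hm hF
  -- The Sobolev loss `θ/Q` must stay below the energy gain `ε`.
  obtain ⟨θ, hθ, hθ1, hθε⟩ : ∃ θ : ℝ, 0 < θ ∧ θ ≤ 1 ∧ θ / Q < ε := by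
    refine ⟨min 1 (Q * ε / 2), by positivity, min_le_left _ _, ?_⟩
    rw [div_lt_iff₀ hQ0]
    have : 0 < Q * ε := by positivity
    exact (min_le_right _ _).trans_lt (by linarith)
  obtain ⟨K₂, hK₂, hsob⟩ := hX.exists_lintegral_le_of_isSobolevZero hN hQ hΩ hΩb hθ hθ1
  obtain ⟨c, hc, htr⟩ := exists_smooth_truncation
  have hθQ : θ / Q ≤ 1 := by rw [div_le_one hQ0]; linarith
  set μ := volume.restrict Ω with hμ
  set A : ℝ → ℝ≥0∞ := fun k => μ (u ⁻¹' {t | k < σ * t}) with hA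
  have hSm : ∀ k, MeasurableSet {t : ℝ | k < σ * t} := fun k =>
    measurableSet_lt measurable_const (measurable_id.const_mul σ)
  have hAt : ∀ k, A k ≠ ⊤ := fun k => measure_ne_top _ _
  have hanti : Antitone A := fun k h hkh => measure_mono fun x hx => lt_of_le_of_lt hkh hx
  have hcut : ∀ k h, 0 ≤ k → k < h →
      ENNReal.ofReal (c * (h - k)) * A h ≤ K₂ * K₁ * A k ^ (1 + (ε - θ / Q)) := by
    intro k h hk hkh
    obtain ⟨f, hf, hf0, hf', hf1, hfH, hfS, hfh⟩ := htr σ k h hσ hk hkh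
    have h1 := hen f hf hf0 hf' hf1 ⟨h, hfH⟩ _ (hSm k) hfS
    -- Here `κ` is carried by the upper level set, on which `|f(u)|` is the constant `c * (h - k)`.
    have h2 := hsob _ _ (hu.1.comp hX.continuous_vectorField hQ.le hf hf0 fun t => by
      rw [abs_of_nonneg (hf' t)]; exact hf1 t) (μ.restrict (u ⁻¹' {t | h < σ * t}))
      Measure.restrict_le_self
    rw [Measure.restrict_apply_univ] at h2
    have hnull : NullMeasurableSet (u ⁻¹' {t | h < σ * t}) μ :=
      hu.1.1.1.aemeasurable.nullMeasurableSet_preimage (hSm h)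
    calc ENNReal.ofReal (c * (h - k)) * A h
        = ∫⁻ _ in u ⁻¹' {t | h < σ * t}, ENNReal.ofReal (c * (h - k)) ∂μ := by
          rw [setLIntegral_const]
      _ ≤ ∫⁻ x in u ⁻¹' {t | h < σ * t}, ‖f (u x)‖ₑ ∂μ := by
          refine lintegral_mono_ae ((ae_restrict_mem₀ hnull).mono fun x hx => ?_)
          rw [Real.enorm_eq_ofReal_abs, hfh _ hx]
      _ ≤ K₂ * A h ^ (1 - θ / Q) * (K₁ * A k ^ ε) := h2.trans (by gcongr)
      _ ≤ K₂ * A k ^ (1 - θ / Q) * (K₁ * A k ^ ε) := by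
          gcongr
          exact hanti hkh.le
      _ = _ := by
          have h3 : 1 + (ε - θ / Q) = (1 - θ / Q) + ε := by ring
          rw [h3, ENNReal.rpow_add_of_nonneg _ _ (by linarith) hε.le]
          ring
  obtain ⟨k, hk⟩ := exists_eq_zero_of_stampacchia (φ := fun k => (A k).toReal)
    (fun _ => ENNReal.toReal_nonneg)
    (fun k h hkh => ENNReal.toReal_mono (hAt k) (hanti hkh)) (K := (K₂ * K₁).toReal / c)
    (by positivity) (sub_pos.2 hθε) fun k h hk hkh => by
      have h1 := hcut k h hk hkh
      have hpos : 0 ≤ 1 + (ε - θ / Q) := by linarith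
      have h2 := ENNReal.toReal_mono (ENNReal.mul_ne_top (ENNReal.mul_ne_top hK₂ hK₁)
        (ENNReal.rpow_ne_top_of_nonneg hpos (hAt k))) h1
      rw [ENNReal.toReal_mul, ENNReal.toReal_mul (a := K₂ * K₁), ← ENNReal.toReal_rpow,
        ENNReal.toReal_ofReal (mul_nonneg hc.le (sub_nonneg.2 hkh.le))] at h2
      rw [div_mul_eq_mul_div, le_div_iff₀ hc]
      linarith
  exact ⟨k, (ENNReal.toReal_eq_zero_iff _).1 hk |>.resolve_right (hAt k)⟩

end XElliptic

theorem theorem4p6 {N d : ℕ} (hN : 2 ≤ N) (hd : 2 ≤ d)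
    (X : Fin d → XElliptic.E N → XElliptic.E N) (Q : ℝ) (hQ : 1 < Q)
    (hX : XElliptic.IsAdmissible X Q)
    (Ω : Set (XElliptic.E N)) (hΩ : IsOpen Ω) (hΩb : Bornology.IsBounded Ω)
    (a : XElliptic.E N → ℝ → XElliptic.E d → XElliptic.E d)
    (ha : XElliptic.IsLerayLions Ω Q a)
    (m : ℝ≥0∞) (hm : ENNReal.ofReal (Q / (Q - 1)) < m)
    (F : XElliptic.E N → XElliptic.E d) (hF : MemLp F m (volume.restrict Ω))
    (u : XElliptic.E N → ℝ) (U : XElliptic.E N → XElliptic.E d)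
    (hu : XElliptic.IsWeakSolution X Ω Q a F u U) :
    MemLp u ∞ (volume.restrict Ω) := by
  have key := fun σ : ℝ => hu.exists_measure_superlevel_eq_zero hX (by omega) hQ hΩ hΩb ha hm hF
    (σ := σ)
  obtain ⟨k₁, h₁⟩ := key 1 (by norm_num)
  obtain ⟨k₂, h₂⟩ := key (-1) (by norm_num)
  refine memLp_top_of_bound hu.1.1.1 (max k₁ k₂) ?_
  filter_upwards [measure_eq_zero_iff_ae_notMem.1 h₁, measure_eq_zero_iff_ae_notMem.1 h₂]
    with x hx₁ hx₂
  simp only [not_lt, one_mul, neg_mul] at hx₁ hx₂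
  rw [Real.norm_eq_abs]
  exact abs_le'.2 ⟨hx₁.trans (le_max_left _ _), hx₂.trans (le_max_right _ _)⟩
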